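/- Let $n\ge 1$, let $\mathbb B^n=\{z\in\mathbb C^n:|z|<1\}$ with normalized Lebesgue measure $dm$, and write $z\bar w=\sum_j z_j\overline{w_j}$. Let $1<p<\infty$ and $\frac1p+\frac1q=1$. Definitions. For real $\alpha>-1/p$, $B^p_\alpha$ is the weighted Bergman space of all holomorphic $f$ on $\mathbb B^n$ with $(1-|z|^2)^\alpha f(z)\in L^p(\mathbb B^n,dm)$. A sequence below is a finite or infinite sequence $\{a_k\}_k$ of points of $\mathbb B^n$. It is *$B^p_\alpha$-interpolating* if for all complex numbers $\{v_k\}_k$ with $\sum_k \bigl[(1-|a_k|^2)^{\frac{n+1}p+\alpha}|v_k|\bigr]^p<\infty$ there is $f\in B^p_\alpha$ with $f(a_k)=v_k$ for all $k$. For $a,b\in\mathbb B^n$ let $d(a,b)=|\varphi_a(b)|$ be the invariant (Gleason) distance, where $\varphi_a$ is the involutive automorphism of the ball exchanging $0$ and $a$. A sequence is *separated* if there is $\delta>0$ with $d(a_j,a_k)\ge\delta$ for all $j\ne k$. A sequence is a *finite union* of sequences of some kind if its index set is a finite union of sets on each of which it is of that kind. For $s,t>0$ put $$K(\{a_k\},s,t)=\sup_k\sum_{j:\,j\neq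 k}\frac{(1-|a_k|^2)^s(1-|a_j|^2)^t}{|1-\bar a_k a_j|^{s+t}}\in[0,\infty],$$ and let $A(\alpha,p)=(n+1+\alpha p)\min(1/p,1/q)$. Then: (a) Let $\alpha>-1/p$. If there exists $c_0<1$ such that $$K(\{a_k\},A(\alpha,p),A(\alpha,p))\le 2^{-(n+1+\alpha p)|1-\frac2p|}\,c_0,$$ then $\{a_k\}_k$ is $B^p_\alpha$-interpolating. (b) If $\{a_k\}_k$ is separated, there exists $\alpha>0$ such that $\{a_k\}_k$ is $B^p_\alpha$-interpolating. (c) Let $A(\alpha,p)>n$. There exists $\delta\in(0,1)$ such that any sequence $\{a_k\}_k$ with $d(a_j,a_k)\ge\delta$ for all $j\ne k$ is $B^p_\alpha$-interpolating. (d) Let $A(\alpha,p)>n$. Then $\{a_k\}_k$ is a finite union of separated sequences if and only if it is a finite union of $B^p_\alpha$-interpolating sequences. (In (c) and (d) the condition $A(\alpha,p)>n$ implies $\alpha>-1/p$.) -/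

import Mathlib

open MeasureTheory
open scoped ENNReal

namespace WeightedBergman

noncomputable section

/-- `ℂⁿ` with its Euclidean norm `|z|`.  Mathlib's `inner ℂ a z` is `∑ j, z j * conj (a j)`,
that is, the product `z ā`. -/
abbrev Cn (n : ℕ) : Type := EuclideanSpace ℂ (Fin n)

/-- The open unit ball of `ℂⁿ`. -/
abbrev Ball (n : ℕ) : Set (Cn n) := Metric.ball (0 : Cn n) 1

/-- Lebesgue measure on `ℂⁿ`. -/
def lebesgue (n : ℕ) : Measure (Cn n) :=
  (volume : Measure (Fin n → ℂ)).map (WithLp.toLp 2)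

/-- The normalized Lebesgue measure `dm` on the unit ball: `m` is carried by the ball and
`m (Ball n) = 1`. -/
def ballMeasure (n : ℕ) : Measure (Cn n) :=
  (lebesgue n (Ball n))⁻¹ • (lebesgue n).restrict (Ball n)

/-- `f` belongs to the weighted Bergman space `B_α^p`: it is holomorphic in the unit ball and
`(1 - |z|²)^α f(z)` is in `L^p(dm)`.  The values of `f` outside the ball play no role. -/
def MemBergman {n : ℕ} (p α : ℝ) (f : Cn n → ℂ) : Prop :=
  DifferentiableOn ℂ f (Ball n) ∧
    MemLp (fun z => (((1 - ‖z‖ ^ 2) ^ α : ℝ) : ℂ) * f z) (ENNReal.ofReal p) (ballMeasure n)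

/-- The involutive automorphism of the ball exchanging `0` and `a`,
`φ_a(z) = (a - P_a z - √(1 - |a|²) (z - P_a z)) / (1 - z ā)`, where `P_a z` is the orthogonal
projection of `z` on the line spanned by `a` (and `P_0 = 0`, since `x / 0 = 0`). -/
def ballInvolution {n : ℕ} (a z : Cn n) : Cn n :=
  let P : Cn n := (inner ℂ a z / inner ℂ a a) • a
  (1 - inner ℂ a z)⁻¹ • (a - P - ((Real.sqrt (1 - ‖a‖ ^ 2) : ℝ) : ℂ) • (z - P))

/-- The invariant (Gleason) distance `d(a, b) = |φ_a(b)|`. -/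
def gleasonDist {n : ℕ} (a b : Ball n) : ℝ :=
  ‖ballInvolution (a : Cn n) (b : Cn n)‖

variable {n : ℕ} {ι : Type}

/-- A family of points of the ball is separated. -/
def IsSeparated (a : ι → Ball n) : Prop :=
  ∃ δ : ℝ, 0 < δ ∧ ∀ j k : ι, j ≠ k → δ ≤ gleasonDist (a j) (a k)

/-- `v` belongs to `ℓ_β^p(a)`: the family `(1 - |a_k|²)^β v_k` is in `ℓ^p`. -/
def MemWeightedLp (p β : ℝ) (a : ι → Ball n) (v : ι → ℂ) : Prop :=
  Memℓp (fun k => (((1 - ‖(a k : Cn n)‖ ^ 2) ^ β : ℝ) : ℂ) * v k) (ENNReal.ofReal p)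

/-- `a` is an interpolating sequence for `B_α^p`: every `v` in `ℓ^p_{(n+1)/p+α}(a)` is the
restriction to `a` of a function of `B_α^p`. -/
def IsInterpolating (p α : ℝ) (a : ι → Ball n) : Prop :=
  ∀ v : ι → ℂ, MemWeightedLp p ((n + 1) / p + α) a v →
    ∃ f : Cn n → ℂ, MemBergman p α f ∧ ∀ k, f (a k) = v k

/-- `K(a, s, t) = sup_k ∑_{j ≠ k} (1 - |a_k|²)^s (1 - |a_j|²)^t / |1 - ā_k a_j|^(s+t)`,
with values in `[0, ∞]`. -/
def K (a : ι → Ball n) (s t : ℝ) : ℝ≥0∞ :=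
  ⨆ k : ι, ∑' j : {j : ι // j ≠ k},
    ENNReal.ofReal ((1 - ‖(a k : Cn n)‖ ^ 2) ^ s * (1 - ‖(a j : Cn n)‖ ^ 2) ^ t /
      ‖1 - inner ℂ (a k : Cn n) (a j : Cn n)‖ ^ (s + t))

/-- The family `a` is the union of finitely many subfamilies which all have the property `P`. -/
def IsFiniteUnionOf (P : ∀ κ : Type, (κ → Ball n) → Prop) (a : ι → Ball n) : Prop :=
  ∃ (N : ℕ) (S : Fin N → Set ι), (⋃ i, S i) = Set.univ ∧
    ∀ i, P (S i) (fun k : S i => a k)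

/-- `A(α, p) = (n + 1 + α p) min(1/p, 1/q)`, where `q` is the exponent conjugate to `p`. -/
def critExp (n : ℕ) (p q α : ℝ) : ℝ := (n + 1 + α * p) * min (1 / p) (1 / q)

end

end WeightedBergman

namespace WeightedBergman

open Set Filter Topology

variable {n : ℕ}

/-! ### Geometry of the ball -/

/-! Put X = (n+1)/p + α. Interpolating functions are sought as kernel series f(z) = Σ u_j
(1-|a_j|²)^Y (1 - z ā_j)^{-(X+Y)} with a free exponent Y > n/q. Then (1-|a_k|²)^X f(a_k) is u_k plus
an off-diagonal sum whose coefficients have modulus `gram`. If its rows and columns sum to at most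
some c < 1, Schur's test makes it a contraction of ℓ^p, and a Neumann series produces u
(`isInterpolating_of_gram_bound`). That f lies in the Bergman space follows from Hölder's inequality
with test weights and the Forelli–Rudin estimates, for the integral over the ball and for sums over
separated families (`lintegral_tsum_kernel_lt_top`).

The coefficients are at most 2^|X-Y| (1-d²)^min(X,Y) (`gram_le`). In (a), Y = (n+1+αp)/q makes the
minimum A(α,p) and turns |X-Y| into the exponent of the hypothesis. In (b), Y = X and α is large:
for a separated family the sums of (1-d²)^(n+1) are bounded, and every further power gains a factor
1-δ². In (c) the same gain comes from the room between A(α,p) and n, with δ close to 1. In (d), a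
separated family has boundedly many members within any fixed distance δ < 1 of one of them, so it
splits into finitely many δ-separated families. Conversely, Schwarz's lemma and the uniform
boundedness principle force interpolating families to be separated
(`isSeparated_of_isInterpolating`).

Invariant balls are replaced throughout by images of small Euclidean balls under the affine maps
`chart a`, whose Jacobian is constant. -/

/-- `1 - |z|²`. -/
noncomputable def defect (z : Cn n) : ℝ := 1 - ‖z‖ ^ 2

/-- `|1 - z̄ w|`. -/
noncomputable def pairing (z w : Cn n) : ℝ := ‖1 - inner ℂ z w‖

/-- The numerator of `ballInvolution`. -/
noncomputable def involutionNum (a z : Cn n) : Cn n :=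
  a - (inner ℂ a z / inner ℂ a a) • a -
    ((Real.sqrt (1 - ‖a‖ ^ 2) : ℝ) : ℂ) • (z - (inner ℂ a z / inner ℂ a a) • a)

theorem ballInvolution_eq (a z : Cn n) :
    ballInvolution a z = (1 - inner ℂ a z)⁻¹ • involutionNum a z := rfl

theorem norm_lt_one_of_mem {z : Cn n} (hz : z ∈ Ball n) : ‖z‖ < 1 := by simpa using hz

theorem defect_pos {z : Cn n} (hz : z ∈ Ball n) : 0 < defect z := by
  have := norm_lt_one_of_mem hz
  unfold defect
  nlinarith [norm_nonneg z]

theorem mem_ball_of_defect_pos {z : Cn n} (hz : 0 < defect z) : z ∈ Ball n := by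
  unfold defect at hz
  simp only [Ball, mem_ball_zero_iff]
  nlinarith [norm_nonneg z]

theorem pairing_comm (z w : Cn n) : pairing z w = pairing w z := by
  unfold pairing
  rw [← inner_conj_symm, ← Complex.norm_conj]
  simp

theorem pairing_nonneg (z w : Cn n) : 0 ≤ pairing z w := norm_nonneg _

theorem one_sub_norm_mul_le_pairing (z w : Cn n) : 1 - ‖z‖ * ‖w‖ ≤ pairing z w := by
  have h1 := norm_inner_le_norm (𝕜 := ℂ) z w
  have h2 := norm_sub_norm_le (1 : ℂ) (inner ℂ z w)
  rw [norm_one] at h2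
  unfold pairing
  linarith

theorem defect_le_two_mul_pairing {z w : Cn n} (hz : ‖z‖ ≤ 1) (hw : ‖w‖ ≤ 1) :
    defect z ≤ 2 * pairing z w := by
  have := one_sub_norm_mul_le_pairing z w
  unfold defect
  nlinarith [norm_nonneg z, norm_nonneg w]

theorem pairing_pos {z w : Cn n} (hz : z ∈ Ball n) (hw : w ∈ Ball n) : 0 < pairing z w := by
  have := defect_le_two_mul_pairing (norm_lt_one_of_mem hz).le (norm_lt_one_of_mem hw).le
  linarith [defect_pos hz]

theorem one_sub_inner_ne_zero {z w : Cn n} (hz : z ∈ Ball n) (hw : w ∈ Ball n) :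
    1 - inner ℂ z w ≠ 0 := norm_pos_iff.mp (pairing_pos hz hw)

theorem pairing_le_two {z w : Cn n} (hz : ‖z‖ ≤ 1) (hw : ‖w‖ ≤ 1) : pairing z w ≤ 2 := by
  have h1 := norm_inner_le_norm (𝕜 := ℂ) z w
  have h2 := norm_sub_le (1 : ℂ) (inner ℂ z w)
  rw [norm_one] at h2
  unfold pairing
  nlinarith [norm_nonneg z, norm_nonneg w]

/-- Expand, using s² = 1 - |a|² for the square root s. The case a = 0 is separate because the
projection then divides by zero. -/
theorem inner_involutionNum (a z w : Cn n) (ha : ‖a‖ ≤ 1) :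
    (inner ℂ (involutionNum a z) (involutionNum a w) : ℂ) =
      (1 - inner ℂ z a) * (1 - inner ℂ a w) -
        ((defect a : ℝ) : ℂ) * (1 - inner ℂ z w) := by
  have hs : ((Real.sqrt (1 - ‖a‖ ^ 2) : ℝ) : ℂ) ^ 2 = 1 - inner ℂ a a := by
    rw [inner_self_eq_norm_sq_to_K, ← Complex.ofReal_pow, Real.sq_sqrt (by nlinarith [norm_nonneg a])]
    push_cast; simp
  have hd : ((defect a : ℝ) : ℂ) = 1 - inner ℂ a a := by
    rw [inner_self_eq_norm_sq_to_K]; unfold defect; push_cast; simp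
  have hconj : (starRingEnd ℂ) (inner ℂ a a) = inner ℂ a a := inner_conj_symm a a
  have hconj' : (starRingEnd ℂ) (inner ℂ a z) = inner ℂ z a := inner_conj_symm z a
  rw [hd]
  unfold involutionNum
  set s : ℂ := ((Real.sqrt (1 - ‖a‖ ^ 2) : ℝ) : ℂ) with hsdef
  have hsc : (starRingEnd ℂ) s = s := Complex.conj_ofReal _
  by_cases h0 : a = 0
  · subst h0
    simp only [inner_zero_left, inner_zero_right, sub_zero] at hs ⊢
    simp only [smul_zero, sub_zero, zero_sub, inner_neg_neg, inner_smul_left, inner_smul_right, hsc]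
    linear_combination (inner ℂ z w) * hs
  · have hA : (inner ℂ a a : ℂ) ≠ 0 := inner_self_ne_zero.mpr h0
    simp only [inner_sub_left, inner_sub_right, inner_smul_left, inner_smul_right, map_div₀, hconj,
      hconj', hsc]
    field_simp
    linear_combination (inner ℂ a a * inner ℂ z w - inner ℂ z a * inner ℂ a w) * hs

/-- The fundamental identity of the involution `φ_a`. -/
theorem one_sub_inner_ballInvolution {a z w : Cn n} (ha : ‖a‖ ≤ 1)
    (hz : 1 - inner ℂ a z ≠ 0) (hw : 1 - inner ℂ a w ≠ 0) :
    1 - inner ℂ (ballInvolution a z) (ballInvolution a w) =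
      ((defect a : ℝ) : ℂ) * (1 - inner ℂ z w) /
        ((1 - inner ℂ z a) * (1 - inner ℂ a w)) := by
  have hz' : 1 - inner ℂ z a ≠ 0 := by
    intro h
    apply hz
    have := congrArg (starRingEnd ℂ) h
    simpa using this
  rw [ballInvolution_eq, ballInvolution_eq, inner_smul_left, inner_smul_right,
    inner_involutionNum a z w ha]
  simp only [map_inv₀, map_sub, map_one, inner_conj_symm]
  field_simp
  ring

theorem pairing_ballInvolution {a z w : Cn n} (ha : a ∈ Ball n)
    (hz : z ∈ Ball n) (hw : w ∈ Ball n) :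
    pairing (ballInvolution a z) (ballInvolution a w) =
      defect a * pairing z w / (pairing z a * pairing a w) := by
  unfold pairing
  rw [one_sub_inner_ballInvolution (norm_lt_one_of_mem ha).le (one_sub_inner_ne_zero ha hz)
    (one_sub_inner_ne_zero ha hw)]
  simp [abs_of_pos (defect_pos ha)]

theorem defect_ballInvolution' {a z : Cn n} (ha : ‖a‖ ≤ 1) (hz : 1 - inner ℂ a z ≠ 0) :
    defect (ballInvolution a z) = defect a * defect z / pairing a z ^ 2 := by
  have h := one_sub_inner_ballInvolution ha hz hz
  have h1 : ∀ x : Cn n, 1 - (inner ℂ x x : ℂ) = ((defect x : ℝ) : ℂ) := by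
    intro x
    rw [inner_self_eq_norm_sq_to_K]; unfold defect; push_cast; simp
  have h2 : (1 - inner ℂ z a) * (1 - inner ℂ a z) = ((pairing a z ^ 2 : ℝ) : ℂ) := by
    have : (1 - inner ℂ z a : ℂ) = (starRingEnd ℂ) (1 - inner ℂ a z) := by simp
    rw [this, Complex.conj_mul', pairing]
    push_cast; rfl
  rw [h1, h1, h2] at h
  exact_mod_cast h

theorem defect_ballInvolution {a z : Cn n} (ha : a ∈ Ball n) (hz : z ∈ Ball n) :
    defect (ballInvolution a z) = defect a * defect z / pairing a z ^ 2 :=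
  defect_ballInvolution' (norm_lt_one_of_mem ha).le (one_sub_inner_ne_zero ha hz)

theorem ballInvolution_mem {a z : Cn n} (ha : a ∈ Ball n) (hz : z ∈ Ball n) :
    ballInvolution a z ∈ Ball n := by
  apply mem_ball_of_defect_pos
  rw [defect_ballInvolution ha hz]
  have := defect_pos ha
  have := defect_pos hz
  have := pairing_pos ha hz
  positivity

/-- The involution sends z and w into the ball, where the pairing is at most 2; the fundamental
identity translates this back. It serves as a quasi-triangle inequality. -/
theorem pairing_le_mul_div {a z w : Cn n} (ha : a ∈ Ball n) (hz : z ∈ Ball n) (hw : w ∈ Ball n) :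
    pairing z w ≤ 2 * pairing z a * pairing a w / defect a := by
  have h := pairing_ballInvolution ha hz hw
  have h2 := pairing_le_two (norm_lt_one_of_mem (ballInvolution_mem ha hz)).le
    (norm_lt_one_of_mem (ballInvolution_mem ha hw)).le
  have := defect_pos ha
  have := pairing_pos hz ha
  have := pairing_pos ha hw
  rw [h, div_le_iff₀ (by positivity)] at h2
  rw [le_div_iff₀ (by positivity)]
  linarith

theorem gleasonDist_nonneg (a b : Ball n) : 0 ≤ gleasonDist a b := norm_nonneg _

theorem one_sub_gleasonDist_sq (a b : Ball n) :
    1 - gleasonDist a b ^ 2 = defect (a : Cn n) * defect (b : Cn n) / pairing (a : Cn n) b ^ 2 :=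
  defect_ballInvolution a.2 b.2

theorem gleasonDist_lt_one (a b : Ball n) : gleasonDist a b < 1 :=
  norm_lt_one_of_mem (ballInvolution_mem a.2 b.2)

theorem gleasonDist_comm (a b : Ball n) : gleasonDist a b = gleasonDist b a := by
  have h1 := one_sub_gleasonDist_sq a b
  have h2 := one_sub_gleasonDist_sq b a
  rw [pairing_comm, mul_comm (defect _)] at h1
  rw [← sq_eq_sq₀ (gleasonDist_nonneg _ _) (gleasonDist_nonneg _ _)]
  linarith

/-- Move c to the origin by φ_c, which preserves 1 - d². For the images x, y, the bound |1 - x ȳ| ≤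
1 + |x||y| gives the stronger estimate d ≤ (|x|+|y|)/(1+|x||y|). -/
theorem gleasonDist_triangle (a c b : Ball n) :
    gleasonDist a b ≤ gleasonDist a c + gleasonDist c b := by
  set x := ballInvolution (c : Cn n) a with hx
  set y := ballInvolution (c : Cn n) b with hy
  have hxm : x ∈ Ball n := ballInvolution_mem c.2 a.2
  have hym : y ∈ Ball n := ballInvolution_mem c.2 b.2
  have hd : 1 - gleasonDist a b ^ 2 = defect x * defect y / pairing x y ^ 2 := by
    have hc := defect_pos c.2
    have ha := defect_pos a.2
    have hb := defect_pos b.2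
    have h1 := pairing_pos a.2 c.2
    have h2 := pairing_pos c.2 b.2
    have h3 := pairing_pos a.2 b.2
    rw [one_sub_gleasonDist_sq, hx, hy, defect_ballInvolution c.2 a.2,
      defect_ballInvolution c.2 b.2, pairing_ballInvolution c.2 a.2 b.2, pairing_comm (c : Cn n) a]
    field_simp
  have h1 : gleasonDist a c = ‖x‖ := by rw [gleasonDist_comm]; rfl
  have h2 : gleasonDist c b = ‖y‖ := rfl
  rw [h1, h2]
  have hx1 := norm_lt_one_of_mem hxm
  have hy1 := norm_lt_one_of_mem hym
  have hxp := norm_nonneg x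
  have hyp := norm_nonneg y
  have hp : pairing x y ≤ 1 + ‖x‖ * ‖y‖ := by
    have h1 := norm_inner_le_norm (𝕜 := ℂ) x y
    have h2 := norm_sub_le (1 : ℂ) (inner ℂ x y)
    rw [norm_one] at h2
    unfold pairing
    linarith
  have hpp := pairing_pos hxm hym
  have hm : defect x * defect y / (1 + ‖x‖ * ‖y‖) ^ 2 ≤ 1 - gleasonDist a b ^ 2 := by
    rw [hd]
    have := defect_pos hxm
    have := defect_pos hym
    gcongr
  have he : defect x * defect y / (1 + ‖x‖ * ‖y‖) ^ 2 =
      1 - ((‖x‖ + ‖y‖) / (1 + ‖x‖ * ‖y‖)) ^ 2 := by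
    have : 1 + ‖x‖ * ‖y‖ ≠ 0 := by positivity
    unfold defect
    field_simp
    ring
  rw [he] at hm
  have h3 : gleasonDist a b ≤ (‖x‖ + ‖y‖) / (1 + ‖x‖ * ‖y‖) := by
    apply le_of_sq_le_sq _ (by positivity)
    linarith
  refine h3.trans (div_le_self (by positivity) ?_)
  nlinarith [mul_nonneg hxp hyp]

/-! ### Affine charts of the ball -/

/-- The linear map which multiplies by `s²` on the line spanned by `a` and by `s` on its
orthogonal complement. -/
noncomputable def anisotropic (a : Cn n) (s : ℝ) : Cn n →ₗ[ℂ] Cn n where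
  toFun x := (s : ℂ) • x + (((s ^ 2 - s : ℝ) : ℂ) * (inner ℂ a x / inner ℂ a a)) • a
  map_add' x y := by
    simp only [inner_add_right, add_div, mul_add, add_smul, smul_add]
    abel
  map_smul' c x := by
    simp only [inner_smul_right, RingHom.id_apply, smul_add, smul_smul]
    congr 2 <;> ring

theorem anisotropic_apply (a : Cn n) (s : ℝ) (x : Cn n) :
    anisotropic a s x = (s : ℂ) • x + (((s ^ 2 - s : ℝ) : ℂ) * (inner ℂ a x / inner ℂ a a)) • a :=
  rfl

theorem inner_anisotropic (a : Cn n) (s : ℝ) (x : Cn n) :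
    inner ℂ a (anisotropic a s x) = (s : ℂ) ^ 2 * inner ℂ a x := by
  rw [anisotropic_apply, inner_add_right, inner_smul_right, inner_smul_right]
  by_cases h0 : a = 0
  · simp [h0]
  · have hA : (inner ℂ a a : ℂ) ≠ 0 := inner_self_ne_zero.mpr h0
    field_simp
    push_cast
    ring

/-- The map is s times a rank-one perturbation of the identity with determinant s, hence s^n · s.
For a = 0 the special direction disappears, so that case is excluded. -/
theorem det_anisotropic {a : Cn n} (ha : a ≠ 0) {s : ℝ} (hs : s ≠ 0) :
    LinearMap.det (anisotropic a s) = (s : ℂ) ^ (n + 1) := by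
  have hA : (inner ℂ a a : ℂ) ≠ 0 := inner_self_ne_zero.mpr ha
  have hsc : (s : ℂ) ≠ 0 := by exact_mod_cast hs
  have : anisotropic a s = (s : ℂ) • LinearMap.transvection
      ((((s - 1 : ℝ) : ℂ) / inner ℂ a a) • ((innerSL ℂ a : Cn n →L[ℂ] ℂ) : Cn n →ₗ[ℂ] ℂ)) a := by
    ext1 x
    rw [anisotropic_apply]
    simp only [LinearMap.smul_apply, LinearMap.transvection.apply, smul_add, smul_smul]
    congr 2
    simp
    ring
  rw [this, LinearMap.det_smul, LinearMap.transvection.det]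
  simp only [finrank_euclideanSpace, Fintype.card_fin, LinearMap.smul_apply, smul_eq_mul,
    ContinuousLinearMap.coe_coe, innerSL_apply_apply]
  rw [div_mul_cancel₀ _ hA]
  push_cast
  ring

/-- The affine chart `x ↦ a + T_a x`. -/
noncomputable def chart (a x : Cn n) : Cn n := a + anisotropic a (Real.sqrt (defect a)) x

theorem inner_chart {a : Cn n} (ha : a ∈ Ball n) (x : Cn n) :
    1 - inner ℂ a (chart a x) = ((defect a : ℝ) : ℂ) * (1 - inner ℂ a x) := by
  have : ((defect a : ℝ) : ℂ) = 1 - inner ℂ a a := by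
    rw [inner_self_eq_norm_sq_to_K]; unfold defect; push_cast; simp
  rw [chart, inner_add_right, inner_anisotropic, ← Complex.ofReal_pow,
    Real.sq_sqrt (defect_pos ha).le, this]
  ring

theorem pairing_chart {a : Cn n} (ha : a ∈ Ball n) (x : Cn n) :
    pairing a (chart a x) = defect a * pairing a x := by
  unfold pairing
  rw [inner_chart ha, norm_mul, Complex.norm_real, Real.norm_of_nonneg (defect_pos ha).le]

/-- This is what makes the charts useful: for small x the factor 1 - x ā is close to 1 in modulus,
so the invariant distance from a is comparable to the Euclidean norm of the coordinate. -/
theorem ballInvolution_chart {a : Cn n} (ha : a ∈ Ball n) (x : Cn n) :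
    ballInvolution a (chart a x) = -((1 - inner ℂ a x)⁻¹ • x) := by
  have hd := defect_pos ha
  have hdc : ((defect a : ℝ) : ℂ) ≠ 0 := by exact_mod_cast hd.ne'
  have key : involutionNum a (chart a x) = -(((defect a : ℝ) : ℂ) • x) := by
    have hs : ((Real.sqrt (defect a) : ℝ) : ℂ) ^ 2 = ((defect a : ℝ) : ℂ) := by
      rw [← Complex.ofReal_pow, Real.sq_sqrt hd.le]
    have e1 : Real.sqrt (1 - ‖a‖ ^ 2) = Real.sqrt (defect a) := rfl
    rw [involutionNum, e1, chart, inner_add_right, inner_anisotropic, anisotropic_apply]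
    set s : ℂ := ((Real.sqrt (defect a) : ℝ) : ℂ) with hsd
    by_cases h0 : a = 0
    · subst h0
      simp [smul_smul, ← hs, sq]
    · have hA : (inner ℂ a a : ℂ) ≠ 0 := inner_self_ne_zero.mpr h0
      rw [← hs]
      have e2 : (((Real.sqrt (defect a) ^ 2 - Real.sqrt (defect a) : ℝ)) : ℂ) = s ^ 2 - s := by
        push_cast; rfl
      rw [e2]
      (match_scalars <;> field_simp); ring
  rw [ballInvolution_eq, inner_chart ha, key, mul_inv, smul_neg, smul_smul]
  congr 2
  field_simp

theorem norm_inner_lt_half {a x : Cn n} (ha : a ∈ Ball n) (hx : ‖x‖ < 1 / 4) :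
    3 / 4 < pairing a x ∧ pairing a x < 5 / 4 := by
  have h1 := norm_inner_le_norm (𝕜 := ℂ) a x
  have h2 := norm_sub_norm_le (1 : ℂ) (inner ℂ a x)
  have h3 := norm_sub_le (1 : ℂ) (inner ℂ a x)
  rw [norm_one] at h2 h3
  have ha1 := norm_lt_one_of_mem ha
  have : ‖a‖ * ‖x‖ ≤ ‖x‖ := by nlinarith [norm_nonneg a, norm_nonneg x]
  unfold pairing
  constructor <;> linarith

theorem defect_chart {a x : Cn n} (ha : a ∈ Ball n) (hx : pairing a x ≠ 0) :
    defect (chart a x) = defect a * (pairing a x ^ 2 - ‖x‖ ^ 2) := by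
  have hd := defect_pos ha
  have h1 : 1 - inner ℂ a (chart a x) ≠ 0 := by
    rw [inner_chart ha]
    have : ((defect a : ℝ) : ℂ) ≠ 0 := by exact_mod_cast hd.ne'
    exact mul_ne_zero this (norm_ne_zero_iff.mp hx)
  have h := defect_ballInvolution' (norm_lt_one_of_mem ha).le h1
  rw [pairing_chart ha, ballInvolution_chart ha] at h
  have h2 : defect (-((1 - inner ℂ a x)⁻¹ • x)) = 1 - ‖x‖ ^ 2 / pairing a x ^ 2 := by
    unfold defect pairing
    rw [norm_neg, norm_smul, norm_inv, mul_pow, inv_pow]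
    ring
  rw [h2] at h
  field_simp at h
  linarith

theorem chart_bounds {a x : Cn n} (ha : a ∈ Ball n) (hx : ‖x‖ < 1 / 4) :
    defect a / 2 ≤ defect (chart a x) ∧ defect (chart a x) ≤ 2 * defect a := by
  obtain ⟨h1, h2⟩ := norm_inner_lt_half ha hx
  rw [defect_chart ha (by linarith)]
  have hd := defect_pos ha
  have := norm_nonneg x
  constructor
  -- The radius 1/4 is just small enough: 9/16 - 1/16 = 1/2.
  · have : 1 / 2 ≤ pairing a x ^ 2 - ‖x‖ ^ 2 := by nlinarith
    nlinarith
  · have : pairing a x ^ 2 - ‖x‖ ^ 2 ≤ 2 := by nlinarith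
    nlinarith

theorem chart_mem {a x : Cn n} (ha : a ∈ Ball n) (hx : ‖x‖ < 1 / 4) : chart a x ∈ Ball n :=
  mem_ball_of_defect_pos (by linarith [(chart_bounds ha hx).1, defect_pos ha])

theorem pairing_chart_le {a x z : Cn n} (ha : a ∈ Ball n) (hx : ‖x‖ < 1 / 4) (hz : z ∈ Ball n) :
    pairing z (chart a x) ≤ 3 * pairing z a := by
  have h := pairing_le_mul_div ha hz (chart_mem ha hx)
  rw [pairing_chart ha] at h
  have hd := defect_pos ha
  have := pairing_pos hz ha
  have h2 := (norm_inner_lt_half ha hx).2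
  have : 2 * pairing z a * (defect a * pairing a x) / defect a = 2 * pairing z a * pairing a x := by
    field_simp
  rw [this] at h
  nlinarith

theorem norm_ballInvolution_chart {a : Cn n} (ha : a ∈ Ball n) (x : Cn n) :
    ‖ballInvolution a (chart a x)‖ = ‖x‖ / pairing a x := by
  rw [ballInvolution_chart ha, norm_neg, norm_smul, norm_inv, pairing]
  ring

theorem norm_ballInvolution_chart_le {a x : Cn n} (ha : a ∈ Ball n) (hx : ‖x‖ < 1 / 4) :
    ‖ballInvolution a (chart a x)‖ ≤ 2 * ‖x‖ := by
  rw [norm_ballInvolution_chart ha]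
  obtain ⟨h1, h2⟩ := norm_inner_lt_half ha hx
  rw [div_le_iff₀ (by linarith)]
  nlinarith [norm_nonneg x]

theorem chart_zero (a : Cn n) : chart a 0 = a := by simp [chart]

theorem chart_surjective {a : Cn n} (ha : a ∈ Ball n) (b : Cn n) : ∃ x, chart a x = b := by
  have hd := defect_pos ha
  by_cases h0 : a = 0
  · subst h0
    refine ⟨b, ?_⟩
    simp [chart, anisotropic_apply, defect]
  have hs : Real.sqrt (defect a) ≠ 0 := (Real.sqrt_pos.mpr hd).ne'
  have hdet : IsUnit (LinearMap.det (anisotropic a (Real.sqrt (defect a)))) := by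
    rw [det_anisotropic h0 hs]
    exact (pow_ne_zero _ (by exact_mod_cast hs)).isUnit
  obtain ⟨x, hx⟩ := ((Module.End.isUnit_iff _).mp
    ((LinearMap.isUnit_iff_isUnit_det _).mpr hdet)).surjective (b - a)
  exact ⟨x, by rw [chart, hx]; abel⟩

/-- Points at small distance from `a` have small coordinates in the chart at `a`. -/
theorem norm_le_of_chart_eq {a b : Ball n} {x : Cn n} (hx : chart (a : Cn n) x = b)
    (hab : gleasonDist a b ≤ 1 / 2) : ‖x‖ ≤ 2 * gleasonDist a b := by
  have h : gleasonDist a b = ‖x‖ / pairing (a : Cn n) x := by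
    rw [← norm_ballInvolution_chart a.2, hx]; rfl
  have hp : pairing (a : Cn n) x ≤ 1 + ‖x‖ := by
    have h1 := norm_inner_le_norm (𝕜 := ℂ) (a : Cn n) x
    have h2 := norm_sub_le (1 : ℂ) (inner ℂ (a : Cn n) x)
    rw [norm_one] at h2
    have ha1 := norm_lt_one_of_mem a.2
    unfold pairing
    nlinarith [norm_nonneg x]
  have hp0 : 0 < pairing (a : Cn n) x := by
    have := pairing_chart a.2 x
    rw [hx] at this
    have h1 := pairing_pos a.2 b.2
    rw [this] at h1
    exact pos_of_mul_pos_right h1 (defect_pos a.2).le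
  -- Writing d for the distance and using pairing ≤ 1 + ‖x‖, this becomes (1 - d)‖x‖ ≤ d, and d ≤
  -- 1/2 finishes.
  have h3 : ‖x‖ = gleasonDist a b * pairing (a : Cn n) x := by
    rw [h]; field_simp
  have := gleasonDist_nonneg a b
  nlinarith [norm_nonneg x]

theorem differentiable_chart (a : Cn n) : Differentiable ℂ (chart a) := by
  have : chart a = fun x => a + (LinearMap.toContinuousLinearMap
    (anisotropic a (Real.sqrt (defect a)))) x := rfl
  rw [this]
  fun_prop

/-! ### Lebesgue measure -/

instance isAddHaarMeasure_lebesgue (n : ℕ) : (lebesgue n).IsAddHaarMeasure :=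
  (PiLp.continuousLinearEquiv 2 ℂ (fun _ : Fin n => ℂ)).symm.isAddHaarMeasure_map volume

theorem abs_det_restrictScalars_anisotropic {a : Cn n} (ha : a ≠ 0) {s : ℝ} (hs : s ≠ 0) :
    |LinearMap.det ((anisotropic a s).restrictScalars ℝ)| = s ^ (2 * (n + 1)) := by
  rw [LinearMap.det_restrictScalars, det_anisotropic ha hs, Algebra.norm_complex_eq]
  rw [map_pow]
  change |Complex.normSq (s : ℂ) ^ (n + 1)| = _
  rw [Complex.normSq_ofReal, ← sq, ← pow_mul, abs_of_nonneg (by rw [pow_mul]; positivity)]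

theorem lebesgue_anisotropic_image {a : Cn n} (ha : a ≠ 0) {s : ℝ} (hs : s ≠ 0) (S : Set (Cn n)) :
    lebesgue n (anisotropic a s '' S) = ENNReal.ofReal (s ^ (2 * (n + 1))) * lebesgue n S := by
  have := Measure.addHaar_image_linearMap (lebesgue n) ((anisotropic a s).restrictScalars ℝ) S
  rw [abs_det_restrictScalars_anisotropic ha hs] at this
  exact this

theorem chart_zero_left (x : Cn n) : chart (0 : Cn n) x = x := by
  simp [chart, anisotropic_apply, defect]

theorem chart_injective {a : Cn n} (ha : a ∈ Ball n) : Function.Injective (chart a) := by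
  by_cases h0 : a = 0
  · subst h0
    intro x y h
    simpa [chart_zero_left] using h
  have hs : Real.sqrt (defect a) ≠ 0 := (Real.sqrt_pos.mpr (defect_pos ha)).ne'
  have hdet : IsUnit (LinearMap.det (anisotropic a (Real.sqrt (defect a)))) := by
    rw [det_anisotropic h0 hs]
    exact (pow_ne_zero _ (by exact_mod_cast hs)).isUnit
  have := ((Module.End.isUnit_iff _).mp
    ((LinearMap.isUnit_iff_isUnit_det _).mpr hdet)).injective
  intro x y h
  exact this (add_left_cancel h)

/-- The real Jacobian is the squared modulus of the complex determinant, (√(defect a))^(2(n+1)). At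
a = 0 the chart is the identity. -/
theorem lintegral_chart {a : Cn n} (ha : a ∈ Ball n) {S : Set (Cn n)} (hS : MeasurableSet S)
    (g : Cn n → ℝ≥0∞) :
    ∫⁻ w in chart a '' S, g w ∂lebesgue n =
      ENNReal.ofReal (defect a ^ (n + 1)) * ∫⁻ x in S, g (chart a x) ∂lebesgue n := by
  by_cases h0 : a = 0
  · subst h0
    have : chart (0 : Cn n) = id := funext chart_zero_left
    simp [this, defect]
  have hs : Real.sqrt (defect a) ≠ 0 := (Real.sqrt_pos.mpr (defect_pos ha)).ne'
  have hd : ∀ x ∈ S, HasFDerivWithinAt (chart a)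
      (LinearMap.toContinuousLinearMap
        ((anisotropic a (Real.sqrt (defect a))).restrictScalars ℝ)) S x := by
    intro x _
    have h := ((LinearMap.toContinuousLinearMap
        ((anisotropic a (Real.sqrt (defect a))).restrictScalars ℝ)).hasFDerivAt (x := x)).const_add a
    exact h.hasFDerivWithinAt
  rw [lintegral_image_eq_lintegral_abs_det_fderiv_mul (lebesgue n) hS hd
    (chart_injective ha).injOn g, ← lintegral_const_mul' _ _ ENNReal.ofReal_ne_top]
  congr 1
  ext x
  congr 2
  change |LinearMap.det ((anisotropic a (Real.sqrt (defect a))).restrictScalars ℝ)| = _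
  rw [abs_det_restrictScalars_anisotropic h0 hs, pow_mul, Real.sq_sqrt (defect_pos ha).le]

theorem anisotropic_anisotropic_inv {e : Cn n} (he : ‖e‖ = 1) {s : ℝ} (hs : s ≠ 0) (u : Cn n) :
    anisotropic e s (anisotropic e s⁻¹ u) = u := by
  have hA : (inner ℂ e e : ℂ) = 1 := by rw [inner_self_eq_norm_sq_to_K, he]; simp
  have hsc : (s : ℂ) ≠ 0 := by exact_mod_cast hs
  rw [anisotropic_apply e s, inner_anisotropic, anisotropic_apply, hA]
  push_cast
  match_scalars
  · field_simp
  · field_simp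
    ring

/-- Centre at the boundary point e = z/|z|. The component of w - e along e is at most 2t and the
orthogonal one at most 2√t, so rescaling by t and √t leaves a vector of norm at most 2 + 2 = 4. -/
theorem pairing_lt_subset {z : Cn n} (hz : z ∈ Ball n) (hz0 : z ≠ 0) {t : ℝ} (ht : 0 < t) :
    ∃ e : Cn n, e ≠ 0 ∧ {w | w ∈ Ball n ∧ pairing z w < t} ⊆
      (fun x => e + x) '' (anisotropic e (Real.sqrt t) '' Metric.closedBall 0 4) := by
  have hr : 0 < ‖z‖ := norm_pos_iff.mpr hz0
  have hz1 := norm_lt_one_of_mem hz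
  set e : Cn n := ((‖z‖⁻¹ : ℝ) : ℂ) • z with hedef
  have he : ‖e‖ = 1 := by
    rw [hedef, norm_smul, Complex.norm_real, norm_inv, norm_norm, inv_mul_cancel₀ hr.ne']
  have hze : z = ((‖z‖ : ℝ) : ℂ) • e := by
    rw [hedef, smul_smul, ← Complex.ofReal_mul, mul_inv_cancel₀ hr.ne']; simp
  refine ⟨e, norm_pos_iff.mp (by rw [he]; exact one_pos), ?_⟩
  rintro w ⟨hw, hwt⟩
  have hw1 := norm_lt_one_of_mem hw
  have hst : 0 < Real.sqrt t := Real.sqrt_pos.mpr ht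
  have hA : (inner ℂ e e : ℂ) = 1 := by rw [inner_self_eq_norm_sq_to_K, he]; simp
  refine ⟨w - e, ⟨anisotropic e (Real.sqrt t)⁻¹ (w - e), ?_,
    anisotropic_anisotropic_inv he hst.ne' _⟩, by simp⟩
  rw [mem_closedBall_zero_iff]
  set b : ℂ := inner ℂ e w with hb
  have hb1 : ‖b‖ ≤ 1 := by
    have := norm_inner_le_norm (𝕜 := ℂ) e w
    rw [he] at this; linarith
  have hzw : (inner ℂ z w : ℂ) = ((‖z‖ : ℝ) : ℂ) * b := by
    conv_lhs => rw [hze]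
    rw [inner_smul_left, Complex.conj_ofReal]
  have hp : ‖1 - ((‖z‖ : ℝ) : ℂ) * b‖ < t := by
    have := hwt; unfold pairing at this; rwa [hzw] at this
  have h1z : 1 - ‖z‖ < t := by
    have h2 := norm_sub_norm_le (1 : ℂ) (((‖z‖ : ℝ) : ℂ) * b)
    rw [norm_one, norm_mul, Complex.norm_real, norm_norm] at h2
    nlinarith [norm_nonneg b]
  have h1b : ‖1 - b‖ ≤ 2 * t := by
    have : (1 : ℂ) - b = (1 - ((‖z‖ : ℝ) : ℂ) * b) - (((1 - ‖z‖ : ℝ)) : ℂ) * b := by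
      push_cast; ring
    rw [this]
    refine (norm_sub_le _ _).trans ?_
    rw [norm_mul, Complex.norm_real, Real.norm_of_nonneg (by linarith)]
    nlinarith [norm_nonneg b]
  -- By Pythagoras the square is |w|² - |b|² ≤ 1 - |b|² ≤ 2|1 - b| ≤ 4t.
  have hQ : ‖w - b • e‖ ≤ 2 * Real.sqrt t := by
    have hsq : ‖w - b • e‖ ^ 2 = ‖w‖ ^ 2 - ‖b‖ ^ 2 := by
      have h := norm_sub_sq (𝕜 := ℂ) w (b • e)
      rw [h, norm_smul, he, inner_smul_right, ← inner_conj_symm, ← hb, Complex.mul_conj']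
      have : RCLike.re (((‖b‖ : ℝ) : ℂ) ^ 2) = ‖b‖ ^ 2 := by
        rw [← Complex.ofReal_pow]; exact Complex.ofReal_re _
      rw [this]; ring
    have h2 := norm_sub_norm_le (1 : ℂ) b
    rw [norm_one] at h2
    apply le_of_sq_le_sq _ (by positivity)
    rw [hsq, mul_pow, Real.sq_sqrt ht.le]
    nlinarith [norm_nonneg w, norm_nonneg b]
  have hx : anisotropic e (Real.sqrt t)⁻¹ (w - e) =
      (((Real.sqrt t)⁻¹ : ℝ) : ℂ) • (w - b • e) + (((t⁻¹ : ℝ) : ℂ) * (b - 1)) • e := by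
    rw [anisotropic_apply, inner_sub_right, hA, ← hb, inv_pow, Real.sq_sqrt ht.le]
    push_cast
    match_scalars
    · ring
    · ring
  rw [hx]
  refine (norm_add_le _ _).trans ?_
  rw [norm_smul, norm_smul, he, norm_mul, Complex.norm_real, Complex.norm_real,
    Real.norm_of_nonneg (by positivity), Real.norm_of_nonneg (by positivity), norm_sub_rev b 1]
  have e1 : (Real.sqrt t)⁻¹ * ‖w - b • e‖ ≤ 2 := by
    rw [inv_mul_le_iff₀ hst]; linarith
  have e2 : t⁻¹ * ‖1 - b‖ ≤ 2 := by
    rw [inv_mul_le_iff₀ ht]; linarith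
  linarith

/-- Volume of the nonisotropic balls. -/
theorem exists_lebesgue_pairing_lt_le (n : ℕ) :
    ∃ C : ℝ, 0 < C ∧ ∀ z ∈ Ball n, ∀ t : ℝ, 0 < t →
      lebesgue n {w | w ∈ Ball n ∧ pairing z w < t} ≤ ENNReal.ofReal (C * t ^ (n + 1)) := by
  have hfin : lebesgue n (Metric.closedBall 0 4) ≠ ∞ := measure_closedBall_lt_top.ne
  refine ⟨(lebesgue n (Metric.closedBall 0 4)).toReal + 1, by positivity, fun z hz t ht => ?_⟩
  have key : lebesgue n {w | w ∈ Ball n ∧ pairing z w < t} ≤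
      ENNReal.ofReal (t ^ (n + 1)) * lebesgue n (Metric.closedBall 0 4) := by
    by_cases hz0 : z = 0
    · subst hz0
      -- At z = 0 there is no direction e, but the pairing is identically 1, so the set is empty
      -- unless t > 1.
      by_cases ht1 : 1 ≤ t
      · calc _ ≤ lebesgue n (Metric.closedBall 0 4) := by
              apply measure_mono
              rintro w ⟨hw, -⟩
              have := norm_lt_one_of_mem hw
              rw [mem_closedBall_zero_iff]; linarith
          _ ≤ _ := by
              apply le_mul_of_one_le_left (zero_le)
              rw [ENNReal.one_le_ofReal]
              exact one_le_pow₀ ht1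
      · have : {w : Cn n | w ∈ Ball n ∧ pairing 0 w < t} = ∅ := by
          ext w
          simp only [mem_ofPred_eq, mem_empty_iff_false, iff_false, not_and, pairing,
            inner_zero_left, sub_zero, norm_one]
          intro _ h; linarith
        rw [this]; simp
    · obtain ⟨e, he, hsub⟩ := pairing_lt_subset hz hz0 ht
      refine (measure_mono hsub).trans ?_
      rw [image_add_left, measure_preimage_add,
        lebesgue_anisotropic_image he (Real.sqrt_pos.mpr ht).ne', pow_mul, Real.sq_sqrt ht.le]
  refine key.trans ?_
  rw [mul_comm _ (t ^ (n + 1)), ENNReal.ofReal_mul (by positivity)]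
  gcongr
  rw [ENNReal.le_ofReal_iff_toReal_le hfin (by positivity)]
  linarith

theorem continuous_pairing (z : Cn n) : Continuous (pairing z) := by
  unfold pairing; fun_prop

theorem continuous_defect : Continuous (defect : Cn n → ℝ) := by
  unfold defect; fun_prop

/-- The integral over the ball of a power of the kernel, without weight. -/
theorem exists_lintegral_pairing_rpow_le (n : ℕ) {t : ℝ} (ht : 0 < t) :
    ∃ C : ℝ, 0 < C ∧ ∀ z ∈ Ball n,
      ∫⁻ w in Ball n, ENNReal.ofReal (pairing z w ^ (-(n + 1 + t))) ∂lebesgue n ≤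
        ENNReal.ofReal (C * defect z ^ (-t)) := by
  obtain ⟨C, hC, hvol⟩ := exists_lebesgue_pairing_lt_le n
  set lam : ℝ := n + 1 + t with hlam
  have hgeo : Summable fun k : ℕ => ((2 : ℝ) ^ (-t)) ^ k :=
    summable_geometric_of_lt_one (by positivity)
      (Real.rpow_lt_one_of_one_lt_of_neg (by norm_num) (by linarith))
  have hS0 : 0 ≤ ∑' k : ℕ, ((2 : ℝ) ^ (-t)) ^ k := tsum_nonneg fun k => by positivity
  refine ⟨C * 2 ^ (n + 1) * 2 ^ t * (∑' k : ℕ, ((2 : ℝ) ^ (-t)) ^ k + 1), by positivity,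
    fun z hz => ?_⟩
  set ε : ℝ := 1 - ‖z‖ with hε
  have hz1 := norm_lt_one_of_mem hz
  have hε0 : 0 < ε := by linarith
  -- Dyadic decomposition starting at ε, the least possible size of the pairing. The volume (ε
  -- 2^(k+1))^(n+1) against the kernel (ε 2^k)^(-(n+1+t)) leaves a multiple of ε^(-t) 2^(-kt), a
  -- geometric series.
  let A : ℕ → Set (Cn n) := fun k => {w | w ∈ Ball n ∧ pairing z w < ε * 2 ^ (k + 1)}
  have hAm : ∀ k, MeasurableSet (A k) := fun k =>
    measurableSet_ball.inter (measurableSet_lt (continuous_pairing z).measurable measurable_const)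
  calc ∫⁻ w in Ball n, ENNReal.ofReal (pairing z w ^ (-lam)) ∂lebesgue n
      ≤ ∫⁻ w in Ball n, ∑' k : ℕ, (A k).indicator
          (fun _ => ENNReal.ofReal ((ε * 2 ^ k) ^ (-lam))) w ∂lebesgue n := by
        apply setLIntegral_mono' measurableSet_ball
        intro w hw
        have hw1 := norm_lt_one_of_mem hw
        have h1 : ε ≤ pairing z w := by
          have := one_sub_norm_mul_le_pairing z w
          nlinarith [norm_nonneg z]
        obtain ⟨k, hk1, hk2⟩ := exists_nat_pow_near (x := pairing z w / ε) (y := 2)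
          (by rwa [one_le_div hε0]) (by norm_num)
        rw [le_div_iff₀ hε0, mul_comm] at hk1
        rw [div_lt_iff₀ hε0, mul_comm] at hk2
        refine le_trans ?_ (ENNReal.le_tsum k)
        rw [indicator_of_mem (show w ∈ A k from ⟨hw, hk2⟩)]
        apply ENNReal.ofReal_le_ofReal
        exact Real.rpow_le_rpow_of_nonpos (by positivity) hk1 (by simp only [hlam]; linarith)
    _ ≤ ∑' k : ℕ, ∫⁻ w, (A k).indicator
          (fun _ => ENNReal.ofReal ((ε * 2 ^ k) ^ (-lam))) w ∂lebesgue n := by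
        rw [lintegral_tsum fun k => (measurable_const.indicator (hAm k)).aemeasurable]
        exact ENNReal.tsum_le_tsum fun k => setLIntegral_le_lintegral _ _
    _ ≤ ∑' k : ℕ, ENNReal.ofReal (C * 2 ^ (n + 1) * ε ^ (-t) * ((2 : ℝ) ^ (-t)) ^ k) := by
        refine ENNReal.tsum_le_tsum fun k => ?_
        rw [lintegral_indicator_const (hAm k)]
        refine (mul_le_mul_right (hvol z hz (ε * 2 ^ (k + 1)) (by positivity)) _).trans ?_
        rw [← ENNReal.ofReal_mul (by positivity)]
        apply ENNReal.ofReal_le_ofReal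
        have e1 : (ε * 2 ^ k : ℝ) ^ (-lam) = (ε * 2 ^ k) ^ (-t) * ((ε * 2 ^ k) ^ (n + 1))⁻¹ := by
          rw [show -lam = -t + -((n + 1 : ℕ) : ℝ) by push_cast; rw [hlam]; ring,
            Real.rpow_add (by positivity), Real.rpow_neg (by positivity) ((n + 1 : ℕ) : ℝ),
            Real.rpow_natCast]
        have e2 : (ε * 2 ^ k : ℝ) ^ (-t) = ε ^ (-t) * ((2 : ℝ) ^ (-t)) ^ k := by
          rw [Real.mul_rpow hε0.le (by positivity), ← Real.rpow_natCast, ← Real.rpow_natCast,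
            ← Real.rpow_mul (by norm_num), ← Real.rpow_mul (by norm_num), mul_comm (k : ℝ)]
        rw [e1, e2]
        apply le_of_eq
        rw [show ε * 2 ^ (k + 1) = (ε * 2 ^ k) * 2 by ring, mul_pow (ε * 2 ^ k) 2]
        field_simp
    _ = ENNReal.ofReal (C * 2 ^ (n + 1) * ε ^ (-t) * ∑' k : ℕ, ((2 : ℝ) ^ (-t)) ^ k) := by
        rw [← tsum_mul_left, ENNReal.ofReal_tsum_of_nonneg (fun k => by positivity)
          (hgeo.mul_left _)]
    _ ≤ _ := by
        apply ENNReal.ofReal_le_ofReal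
        have h2 : ε ^ (-t) ≤ 2 ^ t * defect z ^ (-t) := by
          have hd := defect_pos hz
          have : (defect z / 2) ^ (-t) = 2 ^ t * defect z ^ (-t) := by
            rw [Real.div_rpow hd.le (by norm_num), Real.rpow_neg (by norm_num : (0 : ℝ) ≤ 2),
              div_inv_eq_mul, mul_comm]
          rw [← this]
          apply Real.rpow_le_rpow_of_nonpos (by positivity) _ (by linarith)
          unfold defect
          nlinarith [norm_nonneg z]
        have hd := defect_pos hz
        have hdt : 0 ≤ defect z ^ (-t) := by positivity
        calc C * 2 ^ (n + 1) * ε ^ (-t) * ∑' k : ℕ, ((2 : ℝ) ^ (-t)) ^ k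
            ≤ C * 2 ^ (n + 1) * (2 ^ t * defect z ^ (-t)) *
              (∑' k : ℕ, ((2 : ℝ) ^ (-t)) ^ k + 1) := by gcongr; linarith
          _ = _ := by ring

/-! ### Integration in polar coordinates -/

/-- The weight is radial, so polar coordinates allow it to be removed one ray at a time. -/
theorem lintegral_ball_eq_lintegral_polar [NeZero n] {f : Cn n → ℝ≥0∞} (hf : Measurable f) :
    ∫⁻ w in Ball n, f w ∂lebesgue n =
      ∫⁻ ζ : Metric.sphere (0 : Cn n) 1, ∫⁻ r in Ioo (0 : ℝ) 1,
        ENNReal.ofReal (r ^ (Module.finrank ℝ (Cn n) - 1)) * f (r • (ζ : Cn n))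
          ∂volume ∂(lebesgue n).toSphere := by
  have : Nonempty (Fin n) := ⟨0⟩
  have hnt : Nontrivial (Cn n) := inferInstance
  set F : Cn n → ℝ≥0∞ := (Ball n).indicator f with hF
  have hFm : Measurable F := hf.indicator measurableSet_ball
  have hmp := (lebesgue n).measurePreserving_homeomorphUnitSphereProd
  set m := Module.finrank ℝ (Cn n) - 1
  have h1 : ∫⁻ w in Ball n, f w ∂lebesgue n = ∫⁻ x : ({(0 : Cn n)}ᶜ : Set (Cn n)), F x
      ∂((lebesgue n).comap (↑)) := by
    rw [← lintegral_indicator measurableSet_ball, lintegral_subtype_comap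
      (measurableSet_singleton (0 : Cn n)).compl (fun x => F x), restrict_compl_singleton]
  let G : Metric.sphere (0 : Cn n) 1 × Ioi (0 : ℝ) → ℝ≥0∞ := fun p => F ((p.2 : ℝ) • (p.1 : Cn n))
  have hGm : Measurable G := hFm.comp (by fun_prop)
  have h2 : ∫⁻ x : ({(0 : Cn n)}ᶜ : Set (Cn n)), F x ∂((lebesgue n).comap (↑)) =
      ∫⁻ p, G p ∂((lebesgue n).toSphere.prod (Measure.volumeIoiPow m)) := by
    rw [← hmp.lintegral_comp hGm]
    congr 1
    ext x
    simp only [G]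
    congr 1
    have hx : ‖(x : Cn n)‖ ≠ 0 := norm_ne_zero_iff.mpr x.2
    simp [smul_smul, hx]
  rw [h1, h2, lintegral_prod _ hGm.aemeasurable]
  congr 1
  ext ζ
  have hmeas : Measurable fun y : Ioi (0 : ℝ) => G (ζ, y) := hGm.comp measurable_prodMk_left
  rw [Measure.volumeIoiPow, lintegral_withDensity_eq_lintegral_mul _ (by fun_prop) hmeas]
  have h3 := lintegral_subtype_comap (μ := volume) (measurableSet_Ioi (a := (0 : ℝ)))
    (fun r : ℝ => ENNReal.ofReal (r ^ m) * F (r • (ζ : Cn n)))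
  refine h3.trans ?_
  have hζ : ‖(ζ : Cn n)‖ = 1 := norm_eq_of_mem_sphere ζ
  rw [← lintegral_indicator measurableSet_Ioi, ← lintegral_indicator measurableSet_Ioo]
  congr 1
  ext r
  by_cases hr : 0 < r
  · by_cases hr1 : r < 1
    · rw [indicator_of_mem (show r ∈ Ioi (0 : ℝ) from hr),
        indicator_of_mem (show r ∈ Ioo (0 : ℝ) 1 from ⟨hr, hr1⟩), hF, indicator_of_mem]
      simp [norm_smul, hζ, abs_of_pos hr, hr1]
    · rw [indicator_of_mem (show r ∈ Ioi (0 : ℝ) from hr),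
        indicator_of_notMem (fun h => hr1 h.2), hF, indicator_of_notMem, mul_zero]
      simpa [norm_smul, hζ, abs_of_pos hr] using not_lt.mp hr1
  · rw [indicator_of_notMem (by exact hr), indicator_of_notMem (fun h => hr h.1)]

/-! ### Integrals over the unit interval -/

theorem lintegral_Ioo_one_sub (g : ℝ → ℝ≥0∞) :
    ∫⁻ r in Ioo (0 : ℝ) 1, g (1 - r) = ∫⁻ u in Ioo (0 : ℝ) 1, g u := by
  have hmp := (Measure.measurePreserving_sub_left (volume : Measure ℝ) 1)
  have hemb : MeasurableEmbedding (fun r : ℝ => 1 - r) :=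
    (Homeomorph.subLeft (1 : ℝ)).measurableEmbedding
  have := hmp.setLIntegral_comp_preimage_emb hemb g (Ioo 0 1)
  rw [← this]
  congr 2
  ext r; simp

/-- With u = 1 - r, split at u = D: below, bound D + u from below by D and integrate u^c; above,
bound it from below by u and integrate u^(c - lam) to infinity. -/
theorem exists_lintegral_rpow_mul_rpow_le {c lam : ℝ} (hc : -1 < c) (hl : c + 1 < lam) :
    ∃ C : ℝ, 0 < C ∧ ∀ D : ℝ, 0 < D →
      ∫⁻ r in Ioo (0 : ℝ) 1, ENNReal.ofReal ((1 - r) ^ c * (D + (1 - r)) ^ (-lam)) ≤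
        ENNReal.ofReal (C * D ^ (c + 1 - lam)) := by
  have hc1 : 0 < c + 1 := by linarith
  have hl1 : 0 < lam - (c + 1) := by linarith
  refine ⟨1 / (c + 1) + 1 / (lam - (c + 1)), by positivity, fun D hD => ?_⟩
  rw [lintegral_Ioo_one_sub (fun u => ENNReal.ofReal (u ^ c * (D + u) ^ (-lam)))]
  have hsub : Ioo (0 : ℝ) 1 ⊆ Ioc 0 D ∪ Ioi D := by
    intro u hu
    rcases le_or_gt u D with h | h
    · exact Or.inl ⟨hu.1, h⟩
    · exact Or.inr h
  have i1 : ∫⁻ u in Ioc 0 D, ENNReal.ofReal (u ^ c * (D + u) ^ (-lam)) ≤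
      ENNReal.ofReal (1 / (c + 1) * D ^ (c + 1 - lam)) := by
    calc _ ≤ ∫⁻ u in Ioc 0 D, ENNReal.ofReal (D ^ (-lam) * u ^ c) := by
          apply setLIntegral_mono' measurableSet_Ioc
          intro u hu
          apply ENNReal.ofReal_le_ofReal
          rw [mul_comm]
          have := hu.1
          gcongr ?_ * _
          exact Real.rpow_le_rpow_of_nonpos hD (by linarith) (by linarith)
      _ = ENNReal.ofReal (∫ u in Ioc 0 D, D ^ (-lam) * u ^ c) := by
          rw [ofReal_integral_eq_lintegral_ofReal]
          · apply Integrable.const_mul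
            exact (intervalIntegral.intervalIntegrable_rpow' hc).1
          · filter_upwards [ae_restrict_mem measurableSet_Ioc] with u hu
            have := hu.1
            simp only [Pi.zero_apply]
            positivity
      _ = _ := by
          rw [integral_const_mul, ← intervalIntegral.integral_of_le hD.le,
            integral_rpow (Or.inl hc), Real.zero_rpow hc1.ne', sub_zero,
            show c + 1 - lam = -lam + (c + 1) by ring, Real.rpow_add hD (-lam) (c + 1)]
          congr 1; ring
  have i2 : ∫⁻ u in Ioi D, ENNReal.ofReal (u ^ c * (D + u) ^ (-lam)) ≤
      ENNReal.ofReal (1 / (lam - (c + 1)) * D ^ (c + 1 - lam)) := by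
    calc _ ≤ ∫⁻ u in Ioi D, ENNReal.ofReal (u ^ (c - lam)) := by
          apply setLIntegral_mono' measurableSet_Ioi
          intro u hu
          have hu' : D < u := hu
          have hu0 : 0 < u := hD.trans hu'
          apply ENNReal.ofReal_le_ofReal
          rw [sub_eq_add_neg, Real.rpow_add hu0]
          gcongr _ * ?_
          exact Real.rpow_le_rpow_of_nonpos hu0 (by linarith) (by linarith)
      _ = ENNReal.ofReal (∫ u in Ioi D, u ^ (c - lam)) := by
          rw [ofReal_integral_eq_lintegral_ofReal]
          · exact integrableOn_Ioi_rpow_of_lt (by linarith) hD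
          · filter_upwards [ae_restrict_mem measurableSet_Ioi] with u hu
            have hu' : D < u := hu
            have hu0 : 0 < u := hD.trans hu'
            simp only [Pi.zero_apply]
            positivity
      _ = _ := by
          rw [integral_Ioi_rpow_of_lt (by linarith) hD]
          congr 1
          rw [show c - lam + 1 = -(lam - (c + 1)) by ring, show c + 1 - lam = -(lam - (c + 1)) by ring]
          field_simp
  refine (lintegral_mono_set hsub).trans ((lintegral_union_le _ _ _).trans ?_)
  refine (add_le_add i1 i2).trans ?_
  rw [← ENNReal.ofReal_add (by positivity) (by positivity), add_mul]

/-- The interval (1 - D/4, 1) is enough: there D + (1 - r) ≤ 2D, and D ≤ 2 keeps r ≥ 1/2, so the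
Jacobian r^m does no harm. -/
theorem exists_le_lintegral_pow_mul_rpow (m : ℕ) {lam : ℝ} (hl : 0 < lam) :
    ∃ C : ℝ, 0 < C ∧ ∀ D : ℝ, 0 < D → D ≤ 2 →
      ENNReal.ofReal (C * D ^ (1 - lam)) ≤
        ∫⁻ r in Ioo (0 : ℝ) 1, ENNReal.ofReal (r ^ m) *
          ENNReal.ofReal ((D + (1 - r)) ^ (-lam)) := by
  refine ⟨(1 / 2) ^ m * 2 ^ (-lam) / 4, by positivity, fun D hD hD2 => ?_⟩
  calc ENNReal.ofReal ((1 / 2) ^ m * 2 ^ (-lam) / 4 * D ^ (1 - lam))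
      = ENNReal.ofReal ((1 / 2) ^ m * (2 * D) ^ (-lam)) * volume (Ioo (1 - D / 4) 1) := by
        rw [Real.volume_Ioo, ← ENNReal.ofReal_mul (by positivity), Real.mul_rpow (by norm_num) hD.le,
          show 1 - lam = -lam + 1 by ring, Real.rpow_add hD, Real.rpow_one]
        congr 1; ring
    _ = ∫⁻ r in Ioo (1 - D / 4) 1, ENNReal.ofReal ((1 / 2) ^ m * (2 * D) ^ (-lam)) := by
        rw [setLIntegral_const]
    _ ≤ ∫⁻ r in Ioo (1 - D / 4) 1, ENNReal.ofReal (r ^ m) *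
          ENNReal.ofReal ((D + (1 - r)) ^ (-lam)) := by
        apply setLIntegral_mono' measurableSet_Ioo
        intro r hr
        have h1 := hr.1
        have h2 := hr.2
        have h3 : 1 / 2 ≤ r := by linarith
        rw [← ENNReal.ofReal_mul (by positivity)]
        apply ENNReal.ofReal_le_ofReal
        have h4 : (2 * D) ^ (-lam) ≤ (D + (1 - r)) ^ (-lam) :=
          Real.rpow_le_rpow_of_nonpos (by linarith) (by linarith) (by linarith)
        gcongr
    _ ≤ _ := by
        apply lintegral_mono_set
        intro r hr
        exact ⟨by linarith [hr.1], hr.2⟩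

/-! ### Integrals of powers of the kernel over the ball -/

/-- Moving from ζ to rζ changes 1 - ζ z̄ by at most 1 - r, which is itself at most the pairing at
rζ. The factor 3 collects these two facts. -/
theorem pairing_smul_bounds {z ζ : Cn n} (hz : z ∈ Ball n) (hζ : ‖ζ‖ = 1) {r : ℝ}
    (hr : r ∈ Ioo (0 : ℝ) 1) :
    1 / 3 * (pairing z ζ + (1 - r)) ≤ pairing z (r • ζ) ∧
      pairing z (r • ζ) ≤ pairing z ζ + (1 - r) := by
  have hz1 := norm_lt_one_of_mem hz
  have hi := norm_inner_le_norm (𝕜 := ℂ) z ζ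
  rw [hζ, mul_one] at hi
  have hr1 : 0 < 1 - r := by linarith [hr.2]
  have e : (inner ℂ z (r • ζ) : ℂ) = (r : ℂ) * inner ℂ z ζ := by
    rw [show r • ζ = (r : ℂ) • ζ from rfl, inner_smul_right]
  have hdiff : ‖(((1 - r : ℝ)) : ℂ) * inner ℂ z ζ‖ ≤ 1 - r := by
    rw [norm_mul, Complex.norm_real, Real.norm_of_nonneg hr1.le]
    nlinarith
  have a1 : pairing z ζ ≤ pairing z (r • ζ) + (1 - r) := by
    unfold pairing
    rw [e]
    have : (1 - inner ℂ z ζ : ℂ) = (1 - r * inner ℂ z ζ) - (((1 - r : ℝ)) : ℂ) * inner ℂ z ζ := by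
      push_cast; ring
    rw [this]
    exact (norm_sub_le _ _).trans (by linarith)
  have a2 : pairing z (r • ζ) ≤ pairing z ζ + (1 - r) := by
    unfold pairing
    rw [e]
    have : (1 - r * inner ℂ z ζ : ℂ) = (1 - inner ℂ z ζ) + (((1 - r : ℝ)) : ℂ) * inner ℂ z ζ := by
      push_cast; ring
    rw [this]
    exact (norm_add_le _ _).trans (by linarith)
  have a3 : 1 - r ≤ pairing z (r • ζ) := by
    have := one_sub_norm_mul_le_pairing z (r • ζ)
    rw [norm_smul, hζ, Real.norm_of_nonneg hr.1.le] at this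
    nlinarith [norm_nonneg z, hr.1]
  exact ⟨by linarith, a2⟩

theorem pairing_sphere_pos {z ζ : Cn n} (hz : z ∈ Ball n) (hζ : ‖ζ‖ = 1) : 0 < pairing z ζ := by
  have := one_sub_norm_mul_le_pairing z ζ
  rw [hζ] at this
  linarith [norm_lt_one_of_mem hz]

theorem two_rpow_bound {x : ℝ} (h1 : 1 ≤ x) (h2 : x ≤ 2) (c : ℝ) : x ^ c ≤ 2 ^ |c| :=
  (Real.rpow_le_rpow_of_exponent_le h1 (le_abs_self c)).trans
    (Real.rpow_le_rpow (by linarith) h2 (abs_nonneg c))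

/-- The Forelli–Rudin estimate. -/
theorem exists_lintegral_defect_rpow_mul_pairing_rpow_le [NeZero n] {c t : ℝ} (hc : -1 < c)
    (ht : 0 < t) :
    ∃ C : ℝ, 0 < C ∧ ∀ z ∈ Ball n,
      ∫⁻ w in Ball n, ENNReal.ofReal (defect w ^ c * pairing z w ^ (-(n + 1 + c + t)))
        ∂lebesgue n ≤ ENNReal.ofReal (C * defect z ^ (-t)) := by
  have hn : (1 : ℝ) ≤ n := by exact_mod_cast NeZero.one_le
  obtain ⟨C₁, hC₁, h₁⟩ := exists_lintegral_rpow_mul_rpow_le (c := c) (lam := n + 1 + c + t) hc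
    (by linarith)
  obtain ⟨C₂, hC₂, h₂⟩ := exists_le_lintegral_pow_mul_rpow (Module.finrank ℝ (Cn n) - 1)
    (lam := n + 1 + t) (by linarith)
  obtain ⟨C₃, hC₃, h₃⟩ := exists_lintegral_pairing_rpow_le n ht
  set m := Module.finrank ℝ (Cn n) - 1
  set K₁ : ℝ := 2 ^ |c| * 3 ^ (n + 1 + c + t) with hK₁
  have hK₁0 : 0 < K₁ := by positivity
  refine ⟨K₁ * C₁ / C₂ * C₃, by positivity, fun z hz => ?_⟩
  -- On each ray the weighted integral and the unweighted one with exponent n+1+t both have order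
  -- D^(-(n+t)): an upper bound for the first and a lower bound for the second suffice. Integrating
  -- over ζ reduces the claim to the unweighted estimate, with no need for measures of caps on the
  -- sphere.
  have hinner : ∀ ζ : Metric.sphere (0 : Cn n) 1,
      ∫⁻ r in Ioo (0 : ℝ) 1, ENNReal.ofReal (r ^ m) *
        ENNReal.ofReal (defect (r • (ζ : Cn n)) ^ c *
          pairing z (r • (ζ : Cn n)) ^ (-(n + 1 + c + t))) ≤
      ENNReal.ofReal (K₁ * C₁ / C₂) * ∫⁻ r in Ioo (0 : ℝ) 1, ENNReal.ofReal (r ^ m) *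
        ENNReal.ofReal (pairing z (r • (ζ : Cn n)) ^ (-(n + 1 + t))) := by
    intro ζ
    have hζ : ‖(ζ : Cn n)‖ = 1 := norm_eq_of_mem_sphere ζ
    set D := pairing z (ζ : Cn n) with hD
    have hD0 : 0 < D := pairing_sphere_pos hz hζ
    have hD2 : D ≤ 2 := pairing_le_two (norm_lt_one_of_mem hz).le hζ.le
    have hup : ∫⁻ r in Ioo (0 : ℝ) 1, ENNReal.ofReal (r ^ m) *
        ENNReal.ofReal (defect (r • (ζ : Cn n)) ^ c *
          pairing z (r • (ζ : Cn n)) ^ (-(n + 1 + c + t))) ≤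
        ENNReal.ofReal K₁ * ENNReal.ofReal (C₁ * D ^ (c + 1 - (n + 1 + c + t))) := by
      refine le_trans ?_ (mul_le_mul_right (h₁ D hD0) _)
      rw [← lintegral_const_mul' _ _ ENNReal.ofReal_ne_top]
      apply setLIntegral_mono' measurableSet_Ioo
      intro r hr
      obtain ⟨b1, -⟩ := pairing_smul_bounds hz hζ hr
      have hr0 := hr.1
      have hr1 : 0 < 1 - r := by linarith [hr.2]
      have hpd : 0 < D + (1 - r) := by linarith
      rw [← ENNReal.ofReal_mul (by positivity), ← ENNReal.ofReal_mul (by positivity)]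
      apply ENNReal.ofReal_le_ofReal
      have hdef : defect (r • (ζ : Cn n)) = (1 - r) * (1 + r) := by
        unfold defect
        rw [norm_smul, hζ, Real.norm_of_nonneg hr0.le]; ring
      have e1 : defect (r • (ζ : Cn n)) ^ c ≤ (1 - r) ^ c * 2 ^ |c| := by
        rw [hdef, Real.mul_rpow hr1.le (by linarith)]
        gcongr
        exact two_rpow_bound (by linarith) (by linarith) c
      have e2 : pairing z (r • (ζ : Cn n)) ^ (-(n + 1 + c + t)) ≤
          3 ^ (n + 1 + c + t) * (D + (1 - r)) ^ (-(n + 1 + c + t)) := by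
        have : (1 / 3 * (D + (1 - r))) ^ (-(n + 1 + c + t)) =
            3 ^ (n + 1 + c + t) * (D + (1 - r)) ^ (-(n + 1 + c + t)) := by
          rw [Real.mul_rpow (by norm_num) hpd.le, one_div, Real.inv_rpow (by norm_num),
            Real.rpow_neg (by norm_num), inv_inv]
        rw [← this]
        exact Real.rpow_le_rpow_of_nonpos (by positivity) b1 (by linarith)
      have e3 : r ^ m ≤ 1 := pow_le_one₀ hr0.le hr.2.le
      have e4 : 0 ≤ pairing z (r • (ζ : Cn n)) ^ (-(n + 1 + c + t)) :=
        Real.rpow_nonneg (pairing_nonneg _ _) _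
      have e5 : 0 ≤ defect (r • (ζ : Cn n)) ^ c := by
        apply Real.rpow_nonneg; rw [hdef]; nlinarith
      calc r ^ m * (defect (r • (ζ : Cn n)) ^ c *
            pairing z (r • (ζ : Cn n)) ^ (-(n + 1 + c + t)))
          ≤ 1 * (((1 - r) ^ c * 2 ^ |c|) *
            (3 ^ (n + 1 + c + t) * (D + (1 - r)) ^ (-(n + 1 + c + t)))) := by
            gcongr
        _ = _ := by rw [hK₁]; ring
    have hlow : ENNReal.ofReal (C₂ * D ^ (1 - (n + 1 + t))) ≤
        ∫⁻ r in Ioo (0 : ℝ) 1, ENNReal.ofReal (r ^ m) *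
        ENNReal.ofReal (pairing z (r • (ζ : Cn n)) ^ (-(n + 1 + t))) := by
      refine (h₂ D hD0 hD2).trans ?_
      apply setLIntegral_mono' measurableSet_Ioo
      intro r hr
      obtain ⟨b1, b2⟩ := pairing_smul_bounds hz hζ hr
      have hr1 : 0 < 1 - r := by linarith [hr.2]
      gcongr _ * ENNReal.ofReal ?_
      exact Real.rpow_le_rpow_of_nonpos (lt_of_lt_of_le (by positivity) b1) b2 (by linarith)
    refine hup.trans (le_trans (le_of_eq ?_) (mul_le_mul_right hlow _))
    rw [← ENNReal.ofReal_mul (by positivity), ← ENNReal.ofReal_mul (by positivity)]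
    congr 1
    rw [show c + 1 - ((n : ℝ) + 1 + c + t) = 1 - (n + 1 + t) by ring]
    field_simp
  have hm1 : Measurable fun w : Cn n =>
      ENNReal.ofReal (defect w ^ c * pairing z w ^ (-(n + 1 + c + t))) :=
    ((continuous_defect.measurable.pow_const c).mul
      ((continuous_pairing z).measurable.pow_const _)).ennreal_ofReal
  have hm2 : Measurable fun w : Cn n => ENNReal.ofReal (pairing z w ^ (-(n + 1 + t))) :=
    ((continuous_pairing z).measurable.pow_const _).ennreal_ofReal
  calc _ ≤ ENNReal.ofReal (K₁ * C₁ / C₂) *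
        ∫⁻ w in Ball n, ENNReal.ofReal (pairing z w ^ (-(n + 1 + t))) ∂lebesgue n := by
        rw [lintegral_ball_eq_lintegral_polar hm1, lintegral_ball_eq_lintegral_polar hm2,
          ← lintegral_const_mul' _ _ ENNReal.ofReal_ne_top]
        exact lintegral_mono hinner
    _ ≤ ENNReal.ofReal (K₁ * C₁ / C₂) * ENNReal.ofReal (C₃ * defect z ^ (-t)) := by
        gcongr; exact h₃ z hz
    _ = _ := by
        rw [← ENNReal.ofReal_mul (by positivity)]
        congr 1; ring

/-! ### Sums over separated families -/

theorem rpow_comparison {x y : ℝ} (hy : 0 < y) (h1 : y / 2 ≤ x) (h2 : x ≤ 2 * y) (c : ℝ) :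
    2 ^ (-|c|) * y ^ c ≤ x ^ c ∧ x ^ c ≤ 2 ^ |c| * y ^ c := by
  have hx : 0 < x := by linarith
  have key : ∀ u v : ℝ, 0 < u → 0 < v → u ≤ 2 * v → v ≤ 2 * u → u ^ c ≤ 2 ^ |c| * v ^ c := by
    intro u v hu hv huv hvu
    rcases le_total 0 c with hc | hc
    · rw [abs_of_nonneg hc, ← Real.mul_rpow (by norm_num) hv.le]
      exact Real.rpow_le_rpow hu.le huv hc
    · rw [abs_of_nonpos hc]
      have : (2 : ℝ) ^ (-c) * v ^ c = (v / 2) ^ c := by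
        rw [Real.div_rpow hv.le (by norm_num), Real.rpow_neg (by norm_num)]
        field_simp
      rw [this]
      exact Real.rpow_le_rpow_of_nonpos (by positivity) (by linarith) hc
  refine ⟨?_, key x y hx hy h2 (by linarith)⟩
  have := key y x hy hx (by linarith) h2
  rw [Real.rpow_neg (by norm_num), inv_mul_le_iff₀ (by positivity)]
  exact this

theorem measurableSet_chart_image {a : Cn n} (ha : a ∈ Ball n) {S : Set (Cn n)}
    (hS : MeasurableSet S) : MeasurableSet (chart a '' S) :=
  hS.image_of_continuousOn_injOn (differentiable_chart a).continuous.continuousOn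
    (chart_injective ha).injOn

/-- The discrete Forelli–Rudin estimate for separated families. -/
theorem exists_tsum_defect_rpow_mul_pairing_rpow_le [NeZero n] {δ s t : ℝ} (hδ : 0 < δ)
    (hs : n < s) (ht : 0 < t) :
    ∃ C : ℝ, 0 < C ∧ ∀ (ι : Type) [Countable ι] (a : ι → Ball n),
      (∀ j k : ι, j ≠ k → δ ≤ gleasonDist (a j) (a k)) → ∀ z ∈ Ball n,
        ∑' j, ENNReal.ofReal (defect (a j : Cn n) ^ s * pairing z (a j) ^ (-(s + t))) ≤
          ENNReal.ofReal (C * defect z ^ (-t)) := by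
  have hn : (1 : ℝ) ≤ n := by exact_mod_cast NeZero.one_le
  -- The volume of a chart image supplies the missing n+1 powers of the defect, so s > n is exactly
  -- the integrability condition c > -1.
  obtain ⟨C, hC, hFR⟩ := exists_lintegral_defect_rpow_mul_pairing_rpow_le (n := n)
    (c := s - (n + 1)) (by linarith) ht
  have hexp : (n : ℝ) + 1 + (s - (n + 1)) + t = s + t := by ring
  rw [hexp] at hFR
  -- A point common to two chart images would be closer than 2η to both centres, hence 4η ≤ δ makes
  -- the images disjoint; η ≤ 1/4 is the range of the chart estimates.
  set η : ℝ := min (1 / 4) (δ / 4) with hη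
  have hη0 : 0 < η := by positivity
  have hη1 : η ≤ 1 / 4 := min_le_left _ _
  have hη2 : η ≤ δ / 4 := min_le_right _ _
  set V := lebesgue n (Metric.ball 0 η) with hV
  have hVtop : V ≠ ∞ := measure_ball_lt_top.ne
  have hV0 : V ≠ 0 := (Metric.measure_ball_pos _ _ hη0).ne'
  have hVr : 0 < V.toReal := ENNReal.toReal_pos hV0 hVtop
  set κ : ℝ := 2 ^ (-|s - (n + 1)|) * 3 ^ (-(s + t)) with hκ
  have hκ0 : 0 < κ := by positivity
  refine ⟨C / (κ * V.toReal), by positivity, fun ι _ a hsep z hz => ?_⟩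
  set g : Cn n → ℝ≥0∞ := fun w =>
    ENNReal.ofReal (defect w ^ (s - (n + 1)) * pairing z w ^ (-(s + t))) with hg
  let B : ι → Set (Cn n) := fun j => chart (a j : Cn n) '' Metric.ball 0 η
  have hBm : ∀ j, MeasurableSet (B j) := fun j =>
    measurableSet_chart_image (a j).2 measurableSet_ball
  have hBd : Pairwise (Function.onFun Disjoint B) := by
    intro j k hjk
    rw [Function.onFun, Set.disjoint_left]
    rintro w ⟨x, hx, rfl⟩ ⟨y, hy, hxy⟩
    rw [mem_ball_zero_iff] at hx hy
    have hwm : chart (a j : Cn n) x ∈ Ball n := chart_mem (a j).2 (by linarith)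
    let w : Ball n := ⟨chart (a j : Cn n) x, hwm⟩
    have d1 : gleasonDist (a j) w ≤ 2 * ‖x‖ := norm_ballInvolution_chart_le (a j).2 (by linarith)
    have d2 : gleasonDist (a k) w ≤ 2 * ‖y‖ := by
      have := norm_ballInvolution_chart_le (a k).2 (x := y) (by linarith)
      rw [hxy] at this
      exact this
    have := gleasonDist_triangle (a j) w (a k)
    rw [gleasonDist_comm w] at this
    linarith [hsep j k hjk]
  have hlow : ∀ j, ENNReal.ofReal (defect (a j : Cn n) ^ s * pairing z (a j) ^ (-(s + t))) *
      ENNReal.ofReal (κ * V.toReal) ≤ ∫⁻ w in B j, g w ∂lebesgue n := by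
    intro j
    have hd := defect_pos (a j).2
    have hp := pairing_pos hz (a j).2
    rw [lintegral_chart (a j).2 measurableSet_ball]
    have : ENNReal.ofReal (κ * (defect (a j : Cn n) ^ (s - (n + 1)) *
        pairing z (a j) ^ (-(s + t)))) * V ≤
        ∫⁻ x in Metric.ball 0 η, g (chart (a j : Cn n) x) ∂lebesgue n := by
      rw [hV, ← setLIntegral_const]
      apply setLIntegral_mono' measurableSet_ball
      intro x hx
      rw [mem_ball_zero_iff] at hx
      have hx4 : ‖x‖ < 1 / 4 := by linarith
      apply ENNReal.ofReal_le_ofReal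
      obtain ⟨c1, c2⟩ := chart_bounds (a j).2 hx4
      have e1 := (rpow_comparison hd c1 c2 (s - (n + 1))).1
      have e2 : 3 ^ (-(s + t)) * pairing z (a j) ^ (-(s + t)) ≤
          pairing z (chart (a j : Cn n) x) ^ (-(s + t)) := by
        rw [← Real.mul_rpow (by norm_num) hp.le]
        exact Real.rpow_le_rpow_of_nonpos (pairing_pos hz (chart_mem (a j).2 hx4))
          (pairing_chart_le (a j).2 hx4 hz) (by linarith)
      calc κ * (defect (a j : Cn n) ^ (s - (n + 1)) * pairing z (a j) ^ (-(s + t)))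
          = (2 ^ (-|s - (n + 1)|) * defect (a j : Cn n) ^ (s - (n + 1))) *
            (3 ^ (-(s + t)) * pairing z (a j) ^ (-(s + t))) := by rw [hκ]; ring
        _ ≤ _ := by
          apply mul_le_mul e1 e2 (by positivity)
          exact Real.rpow_nonneg (defect_pos (chart_mem (a j).2 hx4)).le _
    refine le_trans (le_of_eq ?_) (mul_le_mul_right this _)
    rw [← ENNReal.ofReal_toReal hVtop, ← ENNReal.ofReal_mul (by positivity),
      ← ENNReal.ofReal_mul (by positivity), ← ENNReal.ofReal_mul (by positivity),
      ENNReal.toReal_ofReal hVr.le]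
    congr 1
    have : defect (a j : Cn n) ^ s =
        defect (a j : Cn n) ^ (n + 1) * defect (a j : Cn n) ^ (s - (n + 1)) := by
      rw [← Real.rpow_natCast, ← Real.rpow_add hd]
      congr 1; push_cast; ring
    rw [this]; ring
  have hsum : (∑' j, ENNReal.ofReal (defect (a j : Cn n) ^ s * pairing z (a j) ^ (-(s + t)))) *
      ENNReal.ofReal (κ * V.toReal) ≤ ENNReal.ofReal (C * defect z ^ (-t)) := by
    rw [← ENNReal.tsum_mul_right]
    calc _ ≤ ∑' j, ∫⁻ w in B j, g w ∂lebesgue n := ENNReal.tsum_le_tsum hlow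
      _ = ∫⁻ w in ⋃ j, B j, g w ∂lebesgue n := (lintegral_iUnion hBm hBd g).symm
      _ ≤ ∫⁻ w in Ball n, g w ∂lebesgue n := by
          apply lintegral_mono_set
          intro w hw
          obtain ⟨j, x, hx, rfl⟩ := mem_iUnion.mp hw
          rw [mem_ball_zero_iff] at hx
          exact chart_mem (a j).2 (by linarith)
      _ ≤ _ := hFR z hz
  rw [← ENNReal.le_div_iff_mul_le (Or.inl (by simp; positivity))
    (Or.inl ENNReal.ofReal_ne_top), ← ENNReal.ofReal_div_of_pos (by positivity)] at hsum
  refine hsum.trans (le_of_eq ?_)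
  congr 1; ring

/-- The square of the modulus of the normalized kernel, which is `1 - d(z, w)²`. -/
noncomputable def affinity (z w : Cn n) : ℝ := defect z * defect w / pairing z w ^ 2

theorem affinity_pos {z w : Cn n} (hz : z ∈ Ball n) (hw : w ∈ Ball n) : 0 < affinity z w := by
  have := defect_pos hz
  have := defect_pos hw
  have := pairing_pos hz hw
  unfold affinity
  positivity

theorem affinity_comm (z w : Cn n) : affinity z w = affinity w z := by
  unfold affinity; rw [pairing_comm, mul_comm (defect z)]

theorem affinity_eq (a b : Ball n) : affinity (a : Cn n) b = 1 - gleasonDist a b ^ 2 :=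
  (one_sub_gleasonDist_sq a b).symm

theorem affinity_rpow {z w : Cn n} (hz : z ∈ Ball n) (hw : w ∈ Ball n) (s : ℝ) :
    affinity z w ^ s = defect z ^ s * (defect w ^ s * pairing z w ^ (-(s + s))) := by
  have h1 := defect_pos hz
  have h2 := defect_pos hw
  have h3 := pairing_pos hz hw
  unfold affinity
  rw [Real.div_rpow (by positivity) (by positivity), Real.mul_rpow h1.le h2.le,
    ← Real.rpow_natCast, ← Real.rpow_mul h3.le, Real.rpow_neg h3.le,
    show ((2 : ℕ) : ℝ) * s = s + s by push_cast; ring]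
  ring

theorem exists_tsum_affinity_rpow_le [NeZero n] {δ s : ℝ} (hδ : 0 < δ) (hs : n < s) :
    ∃ C : ℝ, 0 < C ∧ ∀ (ι : Type) [Countable ι] (a : ι → Ball n),
      (∀ j k : ι, j ≠ k → δ ≤ gleasonDist (a j) (a k)) → ∀ z ∈ Ball n,
        ∑' j, ENNReal.ofReal (affinity z (a j) ^ s) ≤ ENNReal.ofReal C := by
  have hn : (1 : ℝ) ≤ n := by exact_mod_cast NeZero.one_le
  obtain ⟨C, hC, h⟩ := exists_tsum_defect_rpow_mul_pairing_rpow_le (n := n) hδ hs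
    (show 0 < s by linarith)
  refine ⟨C, hC, fun ι _ a hsep z hz => ?_⟩
  have hd := defect_pos hz
  have : ∀ j, ENNReal.ofReal (affinity z (a j) ^ s) = ENNReal.ofReal (defect z ^ s) *
      ENNReal.ofReal (defect (a j : Cn n) ^ s * pairing z (a j) ^ (-(s + s))) := by
    intro j
    rw [← ENNReal.ofReal_mul (by positivity), affinity_rpow hz (a j).2]
  simp_rw [this]
  rw [ENNReal.tsum_mul_left]
  refine (mul_le_mul_right (h ι a hsep z hz) _).trans (le_of_eq ?_)
  rw [← ENNReal.ofReal_mul (by positivity)]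
  congr 1
  rw [Real.rpow_neg hd.le]
  field_simp

/-! ### Splitting a separated family -/

theorem exists_maximal_independent {ι : Type} (R : ι → ι → Prop) (U : Set ι) :
    ∃ I ⊆ U, (∀ j ∈ I, ∀ k ∈ I, j ≠ k → ¬ R j k) ∧
      ∀ k ∈ U, k ∉ I → ∃ j ∈ I, R j k ∨ R k j := by
  obtain ⟨I, hI⟩ := zorn_subset {I : Set ι | I ⊆ U ∧ ∀ j ∈ I, ∀ k ∈ I, j ≠ k → ¬ R j k} (by
    intro c hc hchain
    refine ⟨⋃₀ c, ⟨sUnion_subset fun s hs => (hc hs).1, ?_⟩, fun s hs => subset_sUnion_of_mem hs⟩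
    rintro j ⟨s, hs, hj⟩ k ⟨t, ht, hk⟩ hjk
    rcases hchain.total hs ht with h | h
    · exact (hc ht).2 j (h hj) k hk hjk
    · exact (hc hs).2 j hj k (h hk) hjk)
  refine ⟨I, hI.prop.1, hI.prop.2, fun k hkU hkI => ?_⟩
  by_contra! hno
  have hmem : insert k I ∈ {I : Set ι | I ⊆ U ∧ ∀ j ∈ I, ∀ k ∈ I, j ≠ k → ¬ R j k} := by
    refine ⟨insert_subset hkU hI.prop.1, ?_⟩
    rintro x (rfl | hx) y (rfl | hy) hxy
    · exact absurd rfl hxy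
    · exact (hno y hy).2
    · exact (hno x hx).1
    · exact hI.prop.2 x hx y hy hxy
  exact hkI (hI.le_of_ge hmem (subset_insert k I) (mem_insert k I))

/-- Greedy colouring: repeatedly remove a maximal independent set. A vertex surviving M + 1 rounds
has a neighbour in each of the M + 1 disjoint sets removed, against the degree bound. Maximal sets
replace induction on vertices, so infinite graphs are covered. -/
theorem exists_finite_independent_cover {ι : Type} (R : ι → ι → Prop)
    (hR : ∀ j k, R j k → R k j) (M : ℕ)
    (hM : ∀ (k : ι) (T : Finset ι), (∀ j ∈ T, R j k) → T.card ≤ M) :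
    ∃ S : Fin (M + 1) → Set ι, (⋃ i, S i) = univ ∧
      ∀ i, ∀ j ∈ S i, ∀ k ∈ S i, j ≠ k → ¬ R j k := by
  choose I hIU hI hImax using exists_maximal_independent R
  let U : ℕ → Set ι := fun m => Nat.rec univ (fun _ V => V \ I V) m
  have hU : ∀ m, U (m + 1) = U m \ I (U m) := fun m => rfl
  have hUanti : Antitone U := antitone_nat_of_succ_le fun m => by rw [hU]; exact sdiff_subset
  have hend : U (M + 1) = ∅ := by
    by_contra hne
    obtain ⟨k, hk⟩ := nonempty_iff_ne_empty.mpr hne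
    have hnb : ∀ i : Fin (M + 1), ∃ j ∈ I (U i), R j k := by
      intro i
      have hk1 : k ∈ U (i + 1) := hUanti (show (i : ℕ) + 1 ≤ M + 1 by omega) hk
      rw [hU] at hk1
      obtain ⟨j, hj, h⟩ := hImax (U i) k hk1.1 hk1.2
      exact ⟨j, hj, h.elim id (hR _ _)⟩
    choose f hfI hfR using hnb
    have hlt : ∀ i j : Fin (M + 1), i < j → f i ≠ f j := by
      intro i j hij h
      have h1 : f j ∈ U (i + 1) := hUanti (Nat.succ_le_of_lt hij) (hIU _ (hfI j))
      rw [hU] at h1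
      exact h1.2 (h ▸ hfI i)
    have hinj : Function.Injective f := by
      intro i j h
      rcases lt_trichotomy i j with hij | hij | hij
      · exact absurd h (hlt i j hij)
      · exact hij
      · exact absurd h.symm (hlt j i hij)
    have := hM k (Finset.univ.map ⟨f, hinj⟩) (by simp [hfR])
    simp at this
  refine ⟨fun i => I (U i), ?_, fun i => hI _⟩
  rw [eq_univ_iff_forall]
  intro k
  by_contra hk
  have hall : ∀ m, m ≤ M + 1 → k ∈ U m := by
    intro m
    induction m with
    | zero => intro _; exact mem_univ k
    | succ m ih =>
      intro hm
      rw [hU]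
      exact ⟨ih (by omega), fun h => hk (mem_iUnion.mpr ⟨⟨m, by omega⟩, h⟩)⟩
  have := hall (M + 1) le_rfl
  rw [hend] at this
  exact this

/-- Join indices at distance less than δ. Each neighbour of k contributes at least (1-δ²)^(n+1) to a
sum bounded by C, so degrees are bounded and the graph has a finite colouring. -/
theorem exists_finite_cover_of_separated [NeZero n] {ι : Type} [Countable ι] {a : ι → Ball n}
    (ha : IsSeparated a) {δ : ℝ} (hδ1 : δ < 1) :
    ∃ (N : ℕ) (S : Fin N → Set ι), (⋃ i, S i) = univ ∧
      ∀ i, ∀ j ∈ S i, ∀ k ∈ S i, j ≠ k → δ ≤ gleasonDist (a j) (a k) := by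
  wlog hδ0 : 0 < δ generalizing δ
  · obtain ⟨N, S, h1, h2⟩ := this (δ := 1 / 2) (by norm_num) (by norm_num)
    exact ⟨N, S, h1, fun i j hj k hk hjk => by linarith [h2 i j hj k hk hjk]⟩
  obtain ⟨δ₀, hδ₀, hsep⟩ := ha
  obtain ⟨C, hC, h⟩ := exists_tsum_affinity_rpow_le (n := n) hδ₀
    (show (n : ℝ) < n + 1 by linarith)
  have h1 : 0 < 1 - δ ^ 2 := by nlinarith
  set b : ℝ := (1 - δ ^ 2) ^ ((n : ℝ) + 1) with hb
  have hb0 : 0 < b := by positivity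
  obtain ⟨S, hS1, hS2⟩ := exists_finite_independent_cover
    (fun j k => gleasonDist (a j) (a k) < δ) (fun j k h => by rwa [gleasonDist_comm]) ⌊C / b⌋₊ (by
    intro k T hT
    apply Nat.le_floor
    rw [le_div_iff₀ hb0]
    have h2 : ∑ j ∈ T, ENNReal.ofReal b ≤ ENNReal.ofReal C := by
      refine le_trans (Finset.sum_le_sum fun j hj => ?_)
        ((ENNReal.sum_le_tsum T).trans (h ι a hsep (a k) (a k).2))
      apply ENNReal.ofReal_le_ofReal
      rw [affinity_eq, gleasonDist_comm]
      have := hT j hj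
      have := gleasonDist_nonneg (a j) (a k)
      apply Real.rpow_le_rpow h1.le _ (by positivity)
      nlinarith
    rw [Finset.sum_const, nsmul_eq_mul, ← ENNReal.ofReal_natCast,
      ← ENNReal.ofReal_mul (by positivity), ENNReal.ofReal_le_ofReal_iff hC.le] at h2
    exact h2)
  exact ⟨_, S, hS1, fun i j hj k hk hjk => not_lt.mp (hS2 i j hj k hk hjk)⟩

/-! ### Hölder's inequality for weighted sums -/

/-- Hölder applied to k u = (k H)^(1/q) · (k G)^(1/p) u; the relation between H and G says H^(1/q)
G^(1/p) = 1, since (p-1)/p = 1/q. -/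
theorem tsum_mul_rpow_le {ι : Type} {p q : ℝ} (hpq : p.HolderConjugate q)
    (k u H G : ι → ℝ≥0∞) (hHG : ∀ j, H j ^ (p - 1) * G j = 1) :
    (∑' j, k j * u j) ^ p ≤ (∑' j, k j * H j) ^ (p - 1) * ∑' j, k j * G j * u j ^ p := by
  have hp := hpq.pos
  have hq := hpq.symm.pos
  let : MeasurableSpace ι := ⊤
  have hsum : (1 / q : ℝ) + 1 / p = 1 := by
    have := hpq.inv_add_inv_eq_one
    rw [one_div, one_div]; linarith
  have h := ENNReal.lintegral_mul_le_Lp_mul_Lq (Measure.count : Measure ι) hpq.symm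
    (f := fun j => (k j * H j) ^ (1 / q)) (g := fun j => (k j * G j) ^ (1 / p) * u j)
    measurable_from_top.aemeasurable measurable_from_top.aemeasurable
  simp only [lintegral_count, Pi.mul_apply] at h
  have e1 : ∀ j, (k j * H j) ^ (1 / q) * ((k j * G j) ^ (1 / p) * u j) = k j * u j := by
    intro j
    have hk : k j ^ (1 / q) * k j ^ (1 / p) = k j := by
      rw [← ENNReal.rpow_add_of_nonneg _ _ (by positivity) (by positivity), hsum, ENNReal.rpow_one]
    have hH : H j ^ (1 / q) * G j ^ (1 / p) = 1 := by
      have := congrArg (fun x => x ^ (1 / p)) (hHG j)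
      simp only [ENNReal.one_rpow] at this
      rw [ENNReal.mul_rpow_of_nonneg _ _ (by positivity), ← ENNReal.rpow_mul] at this
      rw [← this]
      congr 2
      rw [← hpq.div_conj_eq_sub_one]
      field_simp
    rw [ENNReal.mul_rpow_of_nonneg _ _ (by positivity),
      ENNReal.mul_rpow_of_nonneg _ _ (by positivity)]
    calc _ = (k j ^ (1 / q) * k j ^ (1 / p)) * (H j ^ (1 / q) * G j ^ (1 / p)) * u j := by ring
      _ = _ := by rw [hk, hH, mul_one]
  have e2 : ∀ j, ((k j * H j) ^ (1 / q)) ^ q = k j * H j := by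
    intro j
    rw [← ENNReal.rpow_mul, one_div_mul_cancel hq.ne', ENNReal.rpow_one]
  have e3 : ∀ j, ((k j * G j) ^ (1 / p) * u j) ^ p = k j * G j * u j ^ p := by
    intro j
    rw [ENNReal.mul_rpow_of_nonneg _ _ hp.le, ← ENNReal.rpow_mul, one_div_mul_cancel hp.ne',
      ENNReal.rpow_one]
  simp_rw [e1, e2, e3] at h
  refine (ENNReal.rpow_le_rpow h hp.le).trans (le_of_eq ?_)
  rw [ENNReal.mul_rpow_of_nonneg _ _ hp.le, ← ENNReal.rpow_mul, ← ENNReal.rpow_mul,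
    one_div_mul_cancel hp.ne', ENNReal.rpow_one, one_div_mul_eq_div, hpq.div_conj_eq_sub_one]

/-! ### Series of kernels -/

/-- The holomorphic kernel `(1 - z ā)^(-M)`. -/
noncomputable def kernel (M : ℝ) (a z : Cn n) : ℂ := (1 - inner ℂ a z) ^ ((-M : ℝ) : ℂ)

theorem norm_kernel (M : ℝ) (a z : Cn n) : ‖kernel M a z‖ = pairing a z ^ (-M) := by
  rw [kernel, Complex.norm_cpow_real, pairing]

theorem one_sub_inner_mem_slitPlane {a z : Cn n} (ha : a ∈ Ball n) (hz : z ∈ Ball n) :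
    1 - inner ℂ a z ∈ Complex.slitPlane := by
  left
  have h1 := norm_inner_le_norm (𝕜 := ℂ) a z
  have h2 := Complex.re_le_norm (inner ℂ a z)
  have ha1 := norm_lt_one_of_mem ha
  have hz1 := norm_lt_one_of_mem hz
  rw [Complex.sub_re, Complex.one_re]
  nlinarith [norm_nonneg a, norm_nonneg z]

theorem hasFDerivAt_kernel (M : ℝ) {a z : Cn n} (ha : a ∈ Ball n) (hz : z ∈ Ball n) :
    HasFDerivAt (kernel M a)
      ((((-M : ℝ) : ℂ) * (1 - inner ℂ a z) ^ (((-M : ℝ) : ℂ) - 1)) • (-innerSL ℂ a)) z := by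
  have h1 : HasFDerivAt (fun z : Cn n => 1 - (inner ℂ a z : ℂ)) (-innerSL ℂ a) z :=
    ((innerSL ℂ a).hasFDerivAt (x := z)).const_sub 1
  have h2 := (Complex.hasStrictDerivAt_cpow_const (c := ((-M : ℝ) : ℂ))
    (one_sub_inner_mem_slitPlane ha hz)).hasDerivAt
  exact h2.comp_hasFDerivAt z h1

theorem norm_fderiv_kernel_le {M : ℝ} (hM : 0 ≤ M) {a z : Cn n} (ha : a ∈ Ball n) {r : ℝ}
    (hr : r < 1) (hz : ‖z‖ < r) :
    ‖(((-M : ℝ) : ℂ) * (1 - inner ℂ a z) ^ (((-M : ℝ) : ℂ) - 1)) • (-innerSL ℂ a)‖ ≤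
      M * (1 - r) ^ (-M - 1) := by
  have ha1 := norm_lt_one_of_mem ha
  rw [norm_smul, norm_neg, innerSL_apply_norm, norm_mul, Complex.norm_real, Real.norm_eq_abs,
    abs_neg, abs_of_nonneg hM]
  have e : ((-M : ℝ) : ℂ) - 1 = ((-M - 1 : ℝ) : ℂ) := by push_cast; ring
  rw [e, Complex.norm_cpow_real]
  have h1 : 1 - r ≤ ‖1 - (inner ℂ a z : ℂ)‖ := by
    have := one_sub_norm_mul_le_pairing a z
    unfold pairing at this
    nlinarith [norm_nonneg a, norm_nonneg z]
  have h2 : ‖1 - (inner ℂ a z : ℂ)‖ ^ (-M - 1) ≤ (1 - r) ^ (-M - 1) :=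
    Real.rpow_le_rpow_of_nonpos (by linarith) h1 (by linarith)
  have h3 : 0 ≤ (1 - r) ^ (-M - 1) := Real.rpow_nonneg (by linarith) _
  calc M * ‖1 - (inner ℂ a z : ℂ)‖ ^ (-M - 1) * ‖a‖ ≤ M * (1 - r) ^ (-M - 1) * 1 := by gcongr
    _ = _ := mul_one _

variable {ι : Type}

theorem differentiableOn_tsum_kernel {M : ℝ} (hM : 0 ≤ M) (a : ι → Ball n) {b : ι → ℂ}
    (hb : Summable fun j => ‖b j‖) :
    DifferentiableOn ℂ (fun z => ∑' j, b j * kernel M (a j : Cn n) z) (Ball n) := by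
  intro z₀ hz₀
  have hz1 := norm_lt_one_of_mem hz₀
  -- A smaller concentric ball containing z₀, on which the kernels have derivatives bounded
  -- uniformly in their pole.
  set r : ℝ := (1 + ‖z₀‖) / 2 with hr
  have hr1 : r < 1 := by linarith
  have hr0 : 0 < r := by have := norm_nonneg z₀; linarith
  have hsub : ∀ x ∈ Metric.ball (0 : Cn n) r, x ∈ Ball n := fun x hx =>
    Metric.ball_subset_ball hr1.le hx
  have hz₀r : z₀ ∈ Metric.ball (0 : Cn n) r := by rw [mem_ball_zero_iff]; linarith
  have h := hasFDerivAt_tsum_of_isPreconnected (𝕜 := ℂ) (s := Metric.ball (0 : Cn n) r)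
    (f := fun j z => b j * kernel M (a j : Cn n) z) (x₀ := 0)
    (f' := fun j z => b j • ((((-M : ℝ) : ℂ) * (1 - inner ℂ (a j : Cn n) z) ^
      (((-M : ℝ) : ℂ) - 1)) • (-innerSL ℂ (a j : Cn n))))
    (u := fun j => ‖b j‖ * (M * (1 - r) ^ (-M - 1))) (hb.mul_right _) Metric.isOpen_ball
    (convex_ball _ _).isPreconnected
    (fun j x hx => (hasFDerivAt_kernel M (a j).2 (hsub x hx)).const_mul (b j))
    (fun j x hx => by
      rw [norm_smul]
      gcongr
      exact norm_fderiv_kernel_le hM (a j).2 hr1 (by simpa using hx))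
    (Metric.mem_ball_self hr0)
    (by
      apply Summable.of_norm
      simpa [kernel] using hb) hz₀r
  exact h.differentiableAt.differentiableWithinAt

/-- The family `u` is `p`-summable. -/
def LpSummable (p : ℝ) (u : ι → ℂ) : Prop := ∑' j, ‖u j‖ₑ ^ p ≠ ∞

/-- A family of points whose mutual distances are bounded below. -/
def SeparatedBy (δ : ℝ) (a : ι → Ball n) : Prop :=
  ∀ j k : ι, j ≠ k → δ ≤ gleasonDist (a j) (a k)

theorem enorm_eq_ofReal_norm_complex (x : ℂ) : ‖x‖ₑ = ENNReal.ofReal ‖x‖ := (ofReal_norm x).symm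

theorem summable_norm_of_tsum_enorm_ne_top {f : ι → ℂ} (h : ∑' j, ‖f j‖ₑ ≠ ∞) :
    Summable fun j => ‖f j‖ := by
  have := ENNReal.summable_toReal h
  simpa using this

/-- The coefficients of the kernel series are absolutely summable. -/
theorem summable_norm_coeff [NeZero n] [Countable ι] {p q Y δ : ℝ} (hpq : p.HolderConjugate q)
    (hY : n / q < Y) (hδ : 0 < δ) {a : ι → Ball n} (ha : SeparatedBy δ a)
    {u : ι → ℂ} (hu : LpSummable p u) :
    Summable fun j => ‖u j * ((defect (a j : Cn n) ^ Y : ℝ) : ℂ)‖ := by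
  have hq := hpq.symm.pos
  have hp := hpq.pos
  apply summable_norm_of_tsum_enorm_ne_top
  obtain ⟨C, hC, h⟩ := exists_tsum_defect_rpow_mul_pairing_rpow_le (n := n) (s := Y * q) (t := 1) hδ
    (by rwa [div_lt_iff₀ hq] at hY) one_pos
  -- At the origin the pairing is 1, which leaves the convergence of Σ (1-|a_j|²)^(Yq), the dual sum
  -- in Hölder's inequality.
  have h0 := h ι a ha 0 (by simp)
  have e0 : ∀ j, pairing (0 : Cn n) (a j) = 1 := by intro j; simp [pairing]
  simp only [e0, Real.one_rpow, mul_one] at h0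
  let : MeasurableSpace ι := ⊤
  have hH := ENNReal.lintegral_mul_le_Lp_mul_Lq (Measure.count : Measure ι) hpq
    (f := fun j => ‖u j‖ₑ) (g := fun j => ENNReal.ofReal (defect (a j : Cn n) ^ Y))
    measurable_from_top.aemeasurable measurable_from_top.aemeasurable
  simp only [lintegral_count, Pi.mul_apply] at hH
  have e1 : ∀ j, ‖u j * ((defect (a j : Cn n) ^ Y : ℝ) : ℂ)‖ₑ =
      ‖u j‖ₑ * ENNReal.ofReal (defect (a j : Cn n) ^ Y) := by
    intro j
    have := defect_pos (a j).2
    rw [enorm_mul, enorm_eq_ofReal_norm_complex (((_ : ℝ) : ℂ)), Complex.norm_real,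
      Real.norm_of_nonneg (by positivity)]
  simp_rw [e1]
  refine (hH.trans_lt ?_).ne
  apply ENNReal.mul_lt_top
  · exact ENNReal.rpow_lt_top_of_nonneg (by positivity) hu
  · apply ENNReal.rpow_lt_top_of_nonneg (by positivity)
    refine (lt_of_le_of_lt ?_ (h0.trans_lt ENNReal.ofReal_lt_top)).ne
    apply ENNReal.tsum_le_tsum
    intro j
    have := defect_pos (a j).2
    rw [ENNReal.ofReal_rpow_of_nonneg (by positivity) hq.le, ← Real.rpow_mul this.le]

/-- The basic weighted estimate for series of kernels. -/
theorem lintegral_tsum_kernel_lt_top [NeZero n] [Countable ι] {p q X Y δ : ℝ}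
    (hpq : p.HolderConjugate q) (hX : n / p < X) (hY : n / q < Y) (hδ : 0 < δ) {a : ι → Ball n}
    (ha : SeparatedBy δ a) {u : ι → ℂ} (hu : LpSummable p u) :
    ∫⁻ z in Ball n, ENNReal.ofReal (defect z ^ (p * X - (n + 1))) *
      (∑' j, ENNReal.ofReal (defect (a j : Cn n) ^ Y * pairing (a j : Cn n) z ^ (-(X + Y))) *
        ‖u j‖ₑ) ^ p ∂lebesgue n < ∞ := by
  have hp := hpq.pos
  have hq := hpq.symm.pos
  have hn : (0 : ℝ) < n := by exact_mod_cast NeZero.pos n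
  have hpq1 : 1 / p + 1 / q = 1 := by
    have := hpq.inv_add_inv_eq_one; rw [one_div, one_div]; exact this
  have hX0 : 0 < X := lt_trans (by positivity) hX
  have hY0 : 0 < Y := lt_trans (by positivity) hY
  have hXY : n < X + Y := by
    have : n / p + n / q = (n : ℝ) := by
      rw [div_eq_mul_one_div, div_eq_mul_one_div (n : ℝ) q, ← mul_add, hpq1, mul_one]
    linarith
  -- The exponent τ of the test weights must satisfy Y + τq > n and X - τq > 0 for the discrete
  -- estimate, X + τp > n and Y - τp > 0 for the integral one. Compatibility of the bounds amounts
  -- to X > n/p, Y > n/q and X + Y > n.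
  obtain ⟨τ, hτ1, hτ2⟩ : ∃ τ : ℝ, max ((n - X) / p) ((n - Y) / q) < τ ∧ τ < min (Y / p) (X / q) := by
    apply exists_between
    have hpq2 := hpq.inv_add_inv_eq_one
    have hn1 : (n : ℝ) * (p⁻¹ + q⁻¹) = n := by rw [hpq2, mul_one]
    have hX1 : X * (p⁻¹ + q⁻¹) = X := by rw [hpq2, mul_one]
    have hY1 : Y * (p⁻¹ + q⁻¹) = Y := by rw [hpq2, mul_one]
    simp only [div_eq_mul_inv] at hX hY ⊢
    have hp' : 0 < p⁻¹ := by positivity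
    have hq' : 0 < q⁻¹ := by positivity
    refine max_lt (lt_min ?_ ?_) (lt_min ?_ ?_) <;> nlinarith
  obtain ⟨hτa, hτb⟩ := max_lt_iff.mp hτ1
  obtain ⟨hτc, hτd⟩ := lt_min_iff.mp hτ2
  rw [div_lt_iff₀ hp] at hτa
  rw [div_lt_iff₀ hq] at hτb
  rw [lt_div_iff₀ hp] at hτc
  rw [lt_div_iff₀ hq] at hτd
  obtain ⟨C₁, hC₁, h₁⟩ := exists_tsum_defect_rpow_mul_pairing_rpow_le (n := n)
    (s := Y + τ * q) (t := X - τ * q) hδ (by linarith) (by linarith)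
  obtain ⟨C₂, hC₂, h₂⟩ := exists_lintegral_defect_rpow_mul_pairing_rpow_le (n := n)
    (c := X + τ * p - (n + 1)) (t := Y - τ * p) (by linarith) (by linarith)
  have hexp1 : Y + τ * q + (X - τ * q) = X + Y := by ring
  have hexp2 : (n : ℝ) + 1 + (X + τ * p - (n + 1)) + (Y - τ * p) = X + Y := by ring
  rw [hexp1] at h₁
  rw [hexp2] at h₂
  have hqp : τ * q * (p - 1) = τ * p := by
    have := hpq.sub_one_mul_conj
    rw [mul_assoc, mul_comm q, this]
  let κ : ι → Cn n → ℝ≥0∞ := fun j z =>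
    ENNReal.ofReal (defect (a j : Cn n) ^ Y * pairing (a j : Cn n) z ^ (-(X + Y)))
  have hm : ∀ j, Measurable fun z : Cn n => ENNReal.ofReal
      (defect z ^ (X + τ * p - (n + 1)) * pairing (a j : Cn n) z ^ (-(X + Y))) := fun j =>
    ((continuous_defect.measurable.pow_const _).mul
      ((continuous_pairing (a j : Cn n)).measurable.pow_const _)).ennreal_ofReal
  have hptw : ∀ z ∈ Ball n, ENNReal.ofReal (defect z ^ (p * X - (n + 1))) *
      (∑' j, κ j z * ‖u j‖ₑ) ^ p ≤ ENNReal.ofReal (C₁ ^ (p - 1)) *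
      ∑' j, (ENNReal.ofReal (defect (a j : Cn n) ^ (Y - τ * p)) * ‖u j‖ₑ ^ p) *
        ENNReal.ofReal (defect z ^ (X + τ * p - (n + 1)) *
          pairing (a j : Cn n) z ^ (-(X + Y))) := by
    intro z hz
    have hdz := defect_pos hz
    -- Test weights H = (1-|a_j|²)^(τq) and G = (1-|a_j|²)^(-τp); the condition on them is q(p-1) =
    -- p.
    have hH := tsum_mul_rpow_le hpq (fun j => κ j z) (fun j => ‖u j‖ₑ)
      (fun j => ENNReal.ofReal (defect (a j : Cn n) ^ (τ * q)))
      (fun j => ENNReal.ofReal (defect (a j : Cn n) ^ (-(τ * p)))) (by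
        intro j
        have hd := defect_pos (a j).2
        rw [ENNReal.ofReal_rpow_of_pos (by positivity), ← ENNReal.ofReal_mul (by positivity),
          ← Real.rpow_mul hd.le, ← Real.rpow_add hd, hqp, add_neg_cancel, Real.rpow_zero,
          ENNReal.ofReal_one])
    have hfirst : ∑' j, κ j z * ENNReal.ofReal (defect (a j : Cn n) ^ (τ * q)) ≤
        ENNReal.ofReal (C₁ * defect z ^ (-(X - τ * q))) := by
      refine le_trans (le_of_eq ?_) (h₁ ι a ha z hz)
      congr 1
      ext j
      have hd := defect_pos (a j).2
      have hpp := pairing_nonneg (a j : Cn n) z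
      simp only [κ]
      rw [← ENNReal.ofReal_mul (by positivity), Real.rpow_add hd, pairing_comm z]
      congr 1; ring
    calc ENNReal.ofReal (defect z ^ (p * X - (n + 1))) * (∑' j, κ j z * ‖u j‖ₑ) ^ p
        ≤ ENNReal.ofReal (defect z ^ (p * X - (n + 1))) *
          (ENNReal.ofReal (C₁ * defect z ^ (-(X - τ * q))) ^ (p - 1) *
            ∑' j, κ j z * ENNReal.ofReal (defect (a j : Cn n) ^ (-(τ * p))) * ‖u j‖ₑ ^ p) := by
          refine mul_le_mul_right (hH.trans (mul_le_mul_left ?_ _)) _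
          exact ENNReal.rpow_le_rpow hfirst hpq.sub_one_pos.le
      _ = ENNReal.ofReal (C₁ ^ (p - 1)) * (ENNReal.ofReal (defect z ^ (X + τ * p - (n + 1))) *
            ∑' j, κ j z * ENNReal.ofReal (defect (a j : Cn n) ^ (-(τ * p))) * ‖u j‖ₑ ^ p) := by
          rw [ENNReal.ofReal_rpow_of_pos (by positivity), ← mul_assoc, ← mul_assoc,
            ← ENNReal.ofReal_mul (by positivity), ← ENNReal.ofReal_mul (by positivity)]
          congr 2
          rw [Real.mul_rpow hC₁.le (by positivity), ← Real.rpow_mul hdz.le, mul_left_comm,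
            ← Real.rpow_add hdz]
          congr 2
          linear_combination hqp
      _ = _ := by
          rw [← ENNReal.tsum_mul_left]
          congr 1
          congr 1
          ext j
          have hd := defect_pos (a j).2
          have hpp := pairing_nonneg (a j : Cn n) z
          simp only [κ]
          rw [ENNReal.ofReal_mul (by positivity), ENNReal.ofReal_mul (by positivity),
            sub_eq_add_neg Y, Real.rpow_add hd, ENNReal.ofReal_mul (by positivity)]
          ring
  refine (setLIntegral_mono' measurableSet_ball hptw).trans_lt ?_
  rw [lintegral_const_mul' _ _ ENNReal.ofReal_ne_top]
  apply ENNReal.mul_lt_top ENNReal.ofReal_lt_top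
  -- After Tonelli, the integral estimate with pole a_j gives (1-|a_j|²)^(-(Y-τp)), which cancels
  -- the weight and leaves Σ |u_j|^p.
  rw [lintegral_tsum fun j => ((hm j).const_mul _).aemeasurable]
  have hlast : ∀ j, ∫⁻ z in Ball n,
      (ENNReal.ofReal (defect (a j : Cn n) ^ (Y - τ * p)) * ‖u j‖ₑ ^ p) *
        ENNReal.ofReal (defect z ^ (X + τ * p - (n + 1)) *
          pairing (a j : Cn n) z ^ (-(X + Y))) ∂lebesgue n ≤ ENNReal.ofReal C₂ * ‖u j‖ₑ ^ p := by
    intro j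
    have hd := defect_pos (a j).2
    rw [lintegral_const_mul _ (hm j)]
    refine (mul_le_mul_right (h₂ (a j) (a j).2) _).trans (le_of_eq ?_)
    rw [mul_right_comm, ← ENNReal.ofReal_mul (by positivity)]
    congr 2
    rw [Real.rpow_neg hd.le]
    field_simp
  refine (ENNReal.tsum_le_tsum hlast).trans_lt ?_
  rw [ENNReal.tsum_mul_left]
  exact ENNReal.mul_lt_top ENNReal.ofReal_lt_top (lt_top_iff_ne_top.mpr hu)

theorem ballMeasure_const_ne_top (n : ℕ) : (lebesgue n (Ball n))⁻¹ ≠ ∞ :=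
  ENNReal.inv_ne_top.mpr (Metric.measure_ball_pos _ _ one_pos).ne'

theorem ballMeasure_const_ne_zero (n : ℕ) : (lebesgue n (Ball n))⁻¹ ≠ 0 :=
  ENNReal.inv_ne_zero.mpr measure_ball_lt_top.ne

/-- Series of kernels with `ℓ^p` coefficients belong to the weighted Bergman space. -/
theorem memBergman_tsum_kernel [NeZero n] [Countable ι] {p q α Y δ : ℝ}
    (hpq : p.HolderConjugate q) (hX : n / p < (n + 1) / p + α) (hY : n / q < Y) (hδ : 0 < δ)
    {a : ι → Ball n} (ha : SeparatedBy δ a) {u : ι → ℂ} (hu : LpSummable p u) :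
    MemBergman p α (fun z => ∑' j, u j * ((defect (a j : Cn n) ^ Y : ℝ) : ℂ) *
      kernel ((n + 1) / p + α + Y) (a j : Cn n) z) := by
  have hp := hpq.pos
  have hq := hpq.symm.pos
  have hX0 : 0 < (n + 1) / p + α := lt_of_le_of_lt (by positivity) hX
  have hY0 : 0 < Y := lt_of_le_of_lt (by positivity) hY
  have hdiff := differentiableOn_tsum_kernel (M := (n + 1) / p + α + Y) (by positivity) a
    (summable_norm_coeff hpq hY hδ ha hu)
  refine ⟨hdiff, ?_, ?_⟩
  · apply AEStronglyMeasurable.smul_measure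
    apply ContinuousOn.aestronglyMeasurable _ measurableSet_ball
    apply ContinuousOn.mul _ hdiff.continuousOn
    apply Complex.continuous_ofReal.comp_continuousOn
    intro z hz
    apply ContinuousAt.continuousWithinAt
    apply ContinuousAt.rpow_const (by fun_prop)
    left
    exact (defect_pos hz).ne'
  · rw [eLpNorm_lt_top_iff_lintegral_rpow_enorm_lt_top (by simpa using hp) ENNReal.ofReal_ne_top,
      ENNReal.toReal_ofReal hp.le, ballMeasure, lintegral_smul_measure, smul_eq_mul]
    apply ENNReal.mul_lt_top (lt_top_iff_ne_top.mpr (ballMeasure_const_ne_top n))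
    refine lt_of_le_of_lt ?_ (lintegral_tsum_kernel_lt_top hpq hX hY hδ ha hu)
    apply setLIntegral_mono' measurableSet_ball
    intro z hz
    have hd := defect_pos hz
    rw [enorm_mul, ENNReal.mul_rpow_of_nonneg _ _ hp.le]
    gcongr
    · rw [enorm_eq_ofReal_norm_complex, Complex.norm_real]
      change ENNReal.ofReal ‖defect z ^ α‖ ^ p ≤ _
      rw [Real.norm_of_nonneg (by positivity), ENNReal.ofReal_rpow_of_pos (by positivity),
        ← Real.rpow_mul hd.le]
      apply le_of_eq
      congr 2
      field_simp
      ring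
    · refine (enorm_tsum_le_tsum_enorm).trans (ENNReal.tsum_le_tsum fun j => ?_)
      have hda := defect_pos (a j).2
      rw [enorm_mul, enorm_mul, enorm_eq_ofReal_norm_complex (((_ : ℝ) : ℂ)), Complex.norm_real,
        Real.norm_of_nonneg (by positivity), enorm_eq_ofReal_norm_complex (kernel _ _ _), norm_kernel,
        mul_assoc, ← ENNReal.ofReal_mul (by positivity), mul_comm]

/-! ### Schur's test and inversion on `ℓ^p` -/

theorem enorm_rpow_eq_ofReal {p : ℝ} (hp : 0 ≤ p) (x : ℂ) : ‖x‖ₑ ^ p = ENNReal.ofReal (‖x‖ ^ p) := by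
  rw [enorm_eq_ofReal_norm_complex, ENNReal.ofReal_rpow_of_nonneg (norm_nonneg _) hp]

theorem memℓp_iff_lpSummable {p : ℝ} (hp : 0 < p) (u : ι → ℂ) :
    Memℓp u (ENNReal.ofReal p) ↔ LpSummable p u := by
  rw [memℓp_gen_iff (by rwa [ENNReal.toReal_ofReal hp.le]), ENNReal.toReal_ofReal hp.le, LpSummable]
  simp_rw [enorm_rpow_eq_ofReal hp.le]
  constructor
  · exact fun h => h.tsum_ofReal_ne_top
  · intro h
    have := ENNReal.summable_toReal h
    refine this.congr fun j => ?_
    rw [ENNReal.toReal_ofReal (by positivity)]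

theorem ofReal_norm_rpow_lp {p : ℝ} (hp : 0 < p) (f : lp (fun _ : ι => ℂ) (ENNReal.ofReal p)) :
    ENNReal.ofReal (‖f‖ ^ p) = ∑' j, ‖f j‖ₑ ^ p := by
  have hp' : 0 < (ENNReal.ofReal p).toReal := by rwa [ENNReal.toReal_ofReal hp.le]
  have h := lp.norm_rpow_eq_tsum hp' f
  have hs := (memℓp_gen_iff hp').mp (lp.memℓp f)
  rw [ENNReal.toReal_ofReal hp.le] at h hs
  simp_rw [enorm_rpow_eq_ofReal hp.le]
  rw [h, ENNReal.ofReal_tsum_of_nonneg (fun j => by positivity) hs]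

/-- Schur's test with constant weights: Hölder in each row costs c^(p-1), and exchanging the sums
brings in the column bound, one more factor c. -/
theorem tsum_enorm_matrix_rpow_le {p q : ℝ} (hpq : p.HolderConjugate q) {E : ι → ι → ℂ} {c : ℝ≥0∞}
    (hrow : ∀ k, ∑' j, ‖E k j‖ₑ ≤ c) (hcol : ∀ j, ∑' k, ‖E k j‖ₑ ≤ c) (u : ι → ℂ) :
    ∑' k, ‖∑' j, E k j * u j‖ₑ ^ p ≤ c ^ p * ∑' j, ‖u j‖ₑ ^ p := by
  have hp1 := hpq.sub_one_pos
  have hterm : ∀ k, ‖∑' j, E k j * u j‖ₑ ^ p ≤ c ^ (p - 1) * ∑' j, ‖E k j‖ₑ * ‖u j‖ₑ ^ p := by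
    intro k
    have h := tsum_mul_rpow_le hpq (fun j => ‖E k j‖ₑ) (fun j => ‖u j‖ₑ) (fun _ => 1) (fun _ => 1)
      (by simp)
    simp only [mul_one] at h
    calc _ ≤ (∑' j, ‖E k j‖ₑ * ‖u j‖ₑ) ^ p := by
          apply ENNReal.rpow_le_rpow _ hpq.pos.le
          refine enorm_tsum_le_tsum_enorm.trans (le_of_eq ?_)
          simp_rw [enorm_mul]
      _ ≤ _ := h.trans (mul_le_mul_left (ENNReal.rpow_le_rpow (hrow k) hp1.le) _)
  calc _ ≤ ∑' k, c ^ (p - 1) * ∑' j, ‖E k j‖ₑ * ‖u j‖ₑ ^ p := ENNReal.tsum_le_tsum hterm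
    _ = c ^ (p - 1) * ∑' j, (∑' k, ‖E k j‖ₑ) * ‖u j‖ₑ ^ p := by
        rw [ENNReal.tsum_mul_left, ENNReal.tsum_comm]
        simp_rw [ENNReal.tsum_mul_right]
    _ ≤ c ^ (p - 1) * ∑' j, c * ‖u j‖ₑ ^ p := by
        gcongr with j
        exact hcol j
    _ = _ := by
        rw [ENNReal.tsum_mul_left, ← mul_assoc]
        congr 1
        conv_rhs => rw [show p = (p - 1) + 1 by ring,
          ENNReal.rpow_add_of_nonneg _ _ hp1.le zero_le_one, ENNReal.rpow_one]

/-- By Schur's test E acts on ℓ^p with norm at most c < 1, so 1 + E is invertible by the Neumann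
series. -/
theorem exists_lp_solution {p q : ℝ} (hpq : p.HolderConjugate q) {E : ι → ι → ℂ} {c : ℝ}
    (hc0 : 0 ≤ c) (hc1 : c < 1) (hrow : ∀ k, ∑' j, ‖E k j‖ₑ ≤ ENNReal.ofReal c)
    (hcol : ∀ j, ∑' k, ‖E k j‖ₑ ≤ ENNReal.ofReal c) {w : ι → ℂ} (hw : LpSummable p w) :
    ∃ u : ι → ℂ, LpSummable p u ∧ ∀ k, u k + ∑' j, E k j * u j = w k := by
  have hp := hpq.pos
  have : Fact (1 ≤ ENNReal.ofReal p) := ⟨by rw [ENNReal.one_le_ofReal]; exact hpq.lt.le⟩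
  let V := lp (fun _ : ι => ℂ) (ENNReal.ofReal p)
  have hp0 : ENNReal.ofReal p ≠ 0 := by simpa using hp
  have hEs : ∀ k, Summable fun j => ‖E k j‖ := fun k =>
    summable_norm_of_tsum_enorm_ne_top ((hrow k).trans_lt ENNReal.ofReal_lt_top).ne
  have hsum : ∀ (u : V) (k : ι), Summable fun j => E k j * u j := by
    intro u k
    apply Summable.of_norm_bounded ((hEs k).mul_right ‖u‖)
    intro j
    rw [norm_mul]
    gcongr
    exact lp.norm_apply_le_norm hp0 u j
  have hbound : ∀ u : V, ∑' k, ‖∑' j, E k j * u j‖ₑ ^ p ≤ ENNReal.ofReal ((c * ‖u‖) ^ p) := by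
    intro u
    refine (tsum_enorm_matrix_rpow_le hpq hrow hcol u).trans (le_of_eq ?_)
    rw [← ofReal_norm_rpow_lp hp u, ENNReal.ofReal_rpow_of_nonneg hc0 hp.le,
      ← ENNReal.ofReal_mul (by positivity), Real.mul_rpow hc0 (norm_nonneg _)]
  let T₀ : V →ₗ[ℂ] V :=
    { toFun := fun u => ⟨fun k => ∑' j, E k j * u j, (memℓp_iff_lpSummable hp _).mpr
        ((hbound u).trans_lt ENNReal.ofReal_lt_top).ne⟩
      map_add' := by
        intro u v
        apply lp.ext
        ext k
        change ∑' j, E k j * (u j + v j) = ∑' j, E k j * u j + ∑' j, E k j * v j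
        simp_rw [mul_add]
        exact (hsum u k).tsum_add (hsum v k)
      map_smul' := by
        intro x u
        apply lp.ext
        ext k
        change ∑' j, E k j * (x * u j) = x * ∑' j, E k j * u j
        rw [← tsum_mul_left]
        congr 1
        ext j
        ring }
  let T : V →L[ℂ] V := T₀.mkContinuous c (by
    intro u
    have h := hbound u
    have h2 := ofReal_norm_rpow_lp hp (T₀ u)
    change _ = ∑' k, ‖∑' j, E k j * u j‖ₑ ^ p at h2
    rw [← h2, ENNReal.ofReal_le_ofReal_iff (by positivity)] at h
    exact (Real.rpow_le_rpow_iff (norm_nonneg _) (by positivity) hp).mp h)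
  have hT : ‖T‖ ≤ c := LinearMap.mkContinuous_norm_le _ hc0 _
  have hunit : IsUnit (1 - (-T)) := isUnit_one_sub_of_norm_lt_one (by rw [norm_neg]; linarith)
  obtain ⟨R, hR⟩ := hunit.exists_right_inv
  let W : V := ⟨w, (memℓp_iff_lpSummable hp _).mpr hw⟩
  refine ⟨R W, (memℓp_iff_lpSummable hp _).mp (lp.memℓp (R W)), fun k => ?_⟩
  have h1 : (1 - (-T)) (R W) = W := by
    have := congrArg (fun A : V →L[ℂ] V => A W) hR
    exact this
  have h2 : R W + T (R W) = W := by simpa [sub_neg_eq_add] using h1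
  have h3 := congrArg (fun v : V => v k) h2
  exact h3

/-! ### A sufficient condition for interpolation -/

/-- The entries of the matrix of the interpolation problem. -/
noncomputable def gram (X Y : ℝ) (z w : Cn n) : ℝ :=
  defect z ^ X * defect w ^ Y * pairing z w ^ (-(X + Y))

theorem gram_comm (X Y : ℝ) (z w : Cn n) : gram X Y z w = gram Y X w z := by
  unfold gram
  rw [pairing_comm, add_comm X Y]
  ring

theorem tsum_ite_ne_eq {f : ι → ℝ≥0∞} {g : ι → ℂ} (k : ι) (hf : ∀ j, j ≠ k → ‖g j‖ₑ = f j)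
    (hg : g k = 0) : ∑' j, ‖g j‖ₑ = ∑' j : {j // j ≠ k}, f j := by
  rw [← tsum_subtype_eq_of_support_subset (s := {j | j ≠ k})]
  · exact tsum_congr fun j => hf j j.2
  · intro j hj
    rintro rfl
    exact hj (by simp [hg])

/-- After weighting by (1-|a_k|²)^X, the values of the kernel series at the points are (1 + E)u, the
diagonal term being exactly u_k. Solving (1 + E)u = w for the weighted data w gives the
interpolating function. -/
theorem isInterpolating_of_gram_bound [NeZero n] [Countable ι] {p q α Y δ c : ℝ}
    (hpq : p.HolderConjugate q) (hX : n / p < (n + 1) / p + α) (hY : n / q < Y) (hδ : 0 < δ)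
    {a : ι → Ball n} (ha : SeparatedBy δ a) (hc0 : 0 ≤ c) (hc1 : c < 1)
    (hrow : ∀ k, ∑' j : {j // j ≠ k},
      ENNReal.ofReal (gram ((n + 1) / p + α) Y (a k : Cn n) (a j)) ≤ ENNReal.ofReal c)
    (hcol : ∀ k, ∑' j : {j // j ≠ k},
      ENNReal.ofReal (gram ((n + 1) / p + α) Y (a j : Cn n) (a k)) ≤ ENNReal.ofReal c) :
    IsInterpolating p α a := by
  classical
  intro v hv
  have hp := hpq.pos
  set X : ℝ := (n + 1) / p + α with hXdef
  rw [MemWeightedLp, memℓp_iff_lpSummable hp] at hv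
  set w : ι → ℂ := fun k => (((1 - ‖(a k : Cn n)‖ ^ 2) ^ X : ℝ) : ℂ) * v k with hw
  let E : ι → ι → ℂ := fun k j => if j = k then 0 else
    ((defect (a k : Cn n) ^ X : ℝ) : ℂ) * ((defect (a j : Cn n) ^ Y : ℝ) : ℂ) *
      kernel (X + Y) (a j : Cn n) (a k)
  have hEn : ∀ k j, j ≠ k → ‖E k j‖ₑ = ENNReal.ofReal (gram X Y (a k : Cn n) (a j)) := by
    intro k j hjk
    have h1 := defect_pos (a k).2
    have h2 := defect_pos (a j).2
    simp only [E, if_neg hjk]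
    rw [enorm_eq_ofReal_norm_complex, norm_mul, norm_mul, Complex.norm_real, Complex.norm_real,
      Real.norm_of_nonneg (by positivity), Real.norm_of_nonneg (by positivity), norm_kernel, gram,
      pairing_comm]
  obtain ⟨u, hu, hsol⟩ := exists_lp_solution hpq (E := E) hc0 hc1
    (fun k => by
      rw [tsum_ite_ne_eq (g := fun j => E k j) k (fun j hj => hEn k j hj) (by simp [E])]
      exact hrow k)
    (fun j => by
      rw [tsum_ite_ne_eq (g := fun k => E k j)
        (f := fun k => ENNReal.ofReal (gram X Y (a k : Cn n) (a j))) j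
        (fun k hk => hEn k j hk.symm) (by simp [E])]
      exact hcol j) hv
  refine ⟨_, memBergman_tsum_kernel hpq hX hY hδ ha hu, fun k => ?_⟩
  have hd := defect_pos (a k).2
  have hdX : ((defect (a k : Cn n) ^ X : ℝ) : ℂ) ≠ 0 := by
    exact_mod_cast (Real.rpow_pos_of_pos hd X).ne'
  have hb := summable_norm_coeff hpq hY hδ ha hu
  have hterm : Summable fun j => u j * ((defect (a j : Cn n) ^ Y : ℝ) : ℂ) *
      kernel (X + Y) (a j : Cn n) (a k) := by
    apply Summable.of_norm_bounded (hb.mul_right ((defect (a k : Cn n) / 2) ^ (-(X + Y))))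
    intro j
    rw [norm_mul, norm_kernel]
    apply mul_le_mul_of_nonneg_left _ (norm_nonneg _)
    have h1 := defect_le_two_mul_pairing (norm_lt_one_of_mem (a k).2).le
      (norm_lt_one_of_mem (a j).2).le
    rw [pairing_comm] at h1
    have hX0 : 0 < X := lt_of_le_of_lt (by positivity) hX
    have hY0 : 0 < Y := lt_of_le_of_lt (by have := hpq.symm.pos; positivity) hY
    exact Real.rpow_le_rpow_of_nonpos (by positivity) (by linarith) (by linarith)
  have hdiag : ((defect (a k : Cn n) ^ X : ℝ) : ℂ) * ((defect (a k : Cn n) ^ Y : ℝ) : ℂ) *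
      kernel (X + Y) (a k : Cn n) (a k) = 1 := by
    have : (1 - (inner ℂ (a k : Cn n) (a k : Cn n) : ℂ)) = ((defect (a k : Cn n) : ℝ) : ℂ) := by
      rw [inner_self_eq_norm_sq_to_K]; unfold defect; push_cast; simp
    rw [kernel, this, ← Complex.ofReal_cpow hd.le, ← Complex.ofReal_mul, ← Complex.ofReal_mul,
      ← Real.rpow_add hd, ← Real.rpow_add hd, add_neg_cancel, Real.rpow_zero, Complex.ofReal_one]
  have hsplit : ((defect (a k : Cn n) ^ X : ℝ) : ℂ) *
      ∑' j, u j * ((defect (a j : Cn n) ^ Y : ℝ) : ℂ) * kernel (X + Y) (a j : Cn n) (a k) =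
      u k + ∑' j, E k j * u j := by
    rw [← tsum_mul_left, (hterm.mul_left _).tsum_eq_add_tsum_ite k]
    congr 1
    · linear_combination (u k) * hdiag
    · congr 1
      ext j
      by_cases hjk : j = k
      · simp [E, hjk]
      · simp only [E, if_neg hjk]
        ring
  have := hsplit.trans (hsol k)
  rw [hw] at this
  exact mul_left_cancel₀ hdX this

/-! ### Mean values over balls -/

/-- Multiplication by a unimodular scalar has real determinant |c^n|² = 1. -/
theorem lintegral_comp_rotation (θ : ℝ) {G : Cn n → ℝ≥0∞} (hG : Measurable G) :
    ∫⁻ x, G (circleMap 0 1 θ • x) ∂lebesgue n = ∫⁻ x, G x ∂lebesgue n := by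
  set c : ℂ := circleMap 0 1 θ with hc
  have hc1 : ‖c‖ = 1 := by simp [hc]
  have hns : Complex.normSq c = 1 := by rw [Complex.normSq_eq_norm_sq, hc1]; norm_num
  set f : Cn n →ₗ[ℝ] Cn n := (c • (LinearMap.id : Cn n →ₗ[ℂ] Cn n)).restrictScalars ℝ with hf
  have hdet : LinearMap.det f = 1 := by
    rw [hf, LinearMap.det_restrictScalars, LinearMap.det_smul, LinearMap.det_id, mul_one,
      Algebra.norm_complex_eq, map_pow]
    change Complex.normSq c ^ _ = 1
    rw [hns, one_pow]
  have hmap := Measure.map_linearMap_addHaar_eq_smul_addHaar (lebesgue n) (f := f)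
    (by rw [hdet]; exact one_ne_zero)
  rw [hdet, inv_one, abs_one, ENNReal.ofReal_one, one_smul] at hmap
  have h2 : ∫⁻ x, G x ∂lebesgue n = ∫⁻ x, G x ∂(Measure.map f (lebesgue n)) := by rw [hmap]
  rw [h2, lintegral_map hG f.continuous_of_finiteDimensional.measurable]
  rfl

/-- The one-variable mean value property of the slice c ↦ g(c x), holomorphic near the closed unit
disc. -/
theorem enorm_mul_le_lintegral_circle {g : Cn n → ℂ} {r : ℝ}
    (hg : DifferentiableOn ℂ g (Metric.ball 0 r)) {x : Cn n} (hx : x ∈ Metric.ball (0 : Cn n) r) :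
    ENNReal.ofReal (2 * Real.pi) * ‖g 0‖ₑ ≤
      ∫⁻ θ in Ioc 0 (2 * Real.pi), ‖g (circleMap 0 1 θ • x)‖ₑ := by
  rw [mem_ball_zero_iff] at hx
  have hr : 0 < r := (norm_nonneg x).trans_lt hx
  set h : ℂ → ℂ := fun c => g (c • x) with hh
  have hmaps : ∀ c ∈ Metric.closedBall (0 : ℂ) 1, c • x ∈ Metric.ball (0 : Cn n) r := by
    intro c hc
    rw [mem_closedBall_zero_iff] at hc
    rw [mem_ball_zero_iff, norm_smul]
    nlinarith [norm_nonneg x, norm_nonneg c]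
  have hd : ∀ c ∈ Metric.closedBall (0 : ℂ) 1, DifferentiableAt ℂ h c := by
    intro c hc
    have h1 := (hg.differentiableAt (Metric.isOpen_ball.mem_nhds (hmaps c hc)))
    exact h1.comp c (by fun_prop)
  have hcd : DiffContOnCl ℂ h (Metric.ball 0 |1|) := by
    rw [abs_one]
    apply DifferentiableOn.diffContOnCl
    rw [closure_ball _ one_ne_zero]
    exact fun c hc => (hd c hc).differentiableWithinAt
  have hav := hcd.circleAverage
  rw [Real.circleAverage_def, inv_smul_eq_iff₀ (by positivity)] at hav
  have h0 : h 0 = g 0 := by simp [hh]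
  rw [h0] at hav
  calc ENNReal.ofReal (2 * Real.pi) * ‖g 0‖ₑ = ‖(2 * Real.pi) • g 0‖ₑ := by
        rw [enorm_smul, Real.enorm_of_nonneg (by positivity)]
    _ = ‖∫ θ in (0 : ℝ)..2 * Real.pi, h (circleMap 0 1 θ)‖ₑ := by rw [hav]
    _ ≤ _ := by
        rw [intervalIntegral.integral_of_le (by positivity)]
        exact enorm_integral_le_lintegral_enorm _

/-- The mean value inequality on balls of `ℂⁿ`. -/
theorem enorm_mul_measure_le_lintegral {g : Cn n → ℂ} {r : ℝ}
    (hg : DifferentiableOn ℂ g (Metric.ball 0 r)) :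
    ‖g 0‖ₑ * lebesgue n (Metric.ball 0 r) ≤ ∫⁻ x in Metric.ball 0 r, ‖g x‖ₑ ∂lebesgue n := by
  -- The circle inequality is integrated over x and the order exchanged; rotation invariance removes
  -- θ. Cutting off to zero gives a globally measurable function, since g is controlled only on the
  -- ball.
  set G : Cn n → ℝ≥0∞ := (Metric.ball 0 r).indicator (fun x => ‖g x‖ₑ) with hG
  have hGm : Measurable G := by
    have h1 : Measurable ((Metric.ball (0 : Cn n) r).indicator g) := by
      classical
      rw [← piecewise_eq_indicator]
      exact ContinuousOn.measurable_piecewise hg.continuousOn continuousOn_const measurableSet_ball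
    have : G = fun x => ‖(Metric.ball (0 : Cn n) r).indicator g x‖ₑ := by
      ext x
      by_cases hx : x ∈ Metric.ball (0 : Cn n) r
      · simp [hG, indicator_of_mem hx]
      · simp [hG, indicator_of_notMem hx]
    rw [this]
    exact h1.enorm
  have hrot : ∀ (θ : ℝ) (x : Cn n), circleMap 0 1 θ • x ∈ Metric.ball (0 : Cn n) r ↔
      x ∈ Metric.ball (0 : Cn n) r := by
    intro θ x
    rw [mem_ball_zero_iff, mem_ball_zero_iff, norm_smul]
    simp
  have h2π : ENNReal.ofReal (2 * Real.pi) ≠ 0 := by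
    simp [Real.pi_pos]
  have key : ENNReal.ofReal (2 * Real.pi) * (‖g 0‖ₑ * lebesgue n (Metric.ball 0 r)) ≤
      ENNReal.ofReal (2 * Real.pi) * ∫⁻ x in Metric.ball 0 r, ‖g x‖ₑ ∂lebesgue n := by
    calc _ = ∫⁻ x in Metric.ball 0 r, ENNReal.ofReal (2 * Real.pi) * ‖g 0‖ₑ ∂lebesgue n := by
          rw [setLIntegral_const]; ring
      _ ≤ ∫⁻ x in Metric.ball 0 r, ∫⁻ θ in Ioc 0 (2 * Real.pi), G (circleMap 0 1 θ • x)
          ∂volume ∂lebesgue n := by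
          apply setLIntegral_mono' measurableSet_ball
          intro x hx
          refine (enorm_mul_le_lintegral_circle hg hx).trans (le_of_eq ?_)
          congr 1
          ext θ
          rw [hG, indicator_of_mem ((hrot θ x).mpr hx)]
      _ ≤ ∫⁻ x, ∫⁻ θ in Ioc 0 (2 * Real.pi), G (circleMap 0 1 θ • x) ∂volume ∂lebesgue n :=
          setLIntegral_le_lintegral _ _
      _ = ∫⁻ θ in Ioc 0 (2 * Real.pi), ∫⁻ x, G (circleMap 0 1 θ • x) ∂lebesgue n := by
          apply lintegral_lintegral_swap
          apply Measurable.aemeasurable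
          apply hGm.comp
          fun_prop
      _ = _ := by
          simp_rw [lintegral_comp_rotation _ hGm]
          rw [setLIntegral_const, Real.volume_Ioc, sub_zero, mul_comm, hG,
            lintegral_indicator measurableSet_ball]
  exact (ENNReal.mul_le_mul_iff_right h2π ENNReal.ofReal_ne_top).mp key

theorem rpow_lintegral_le {S : Set (Cn n)} {p q : ℝ} (hpq : p.HolderConjugate q)
    {F : Cn n → ℝ≥0∞} (hF : AEMeasurable F ((lebesgue n).restrict S)) :
    (∫⁻ x in S, F x ∂lebesgue n) ^ p ≤
      (∫⁻ x in S, F x ^ p ∂lebesgue n) * lebesgue n S ^ (p - 1) := by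
  have h := ENNReal.lintegral_mul_le_Lp_mul_Lq ((lebesgue n).restrict S) hpq hF
    (g := fun _ => 1) aemeasurable_const
  simp only [Pi.mul_apply, mul_one, ENNReal.one_rpow, setLIntegral_one] at h
  refine (ENNReal.rpow_le_rpow h hpq.pos.le).trans (le_of_eq ?_)
  rw [ENNReal.mul_rpow_of_nonneg _ _ hpq.pos.le, ← ENNReal.rpow_mul, ← ENNReal.rpow_mul,
    one_div_mul_cancel hpq.pos.ne', ENNReal.rpow_one, one_div_mul_eq_div, hpq.div_conj_eq_sub_one]

/-! ### Growth and oscillation of functions of the Bergman space -/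

theorem differentiableOn_comp_chart {f : Cn n → ℂ} (hf : DifferentiableOn ℂ f (Ball n)) {a : Cn n}
    (ha : a ∈ Ball n) : DifferentiableOn ℂ (fun x => f (chart a x)) (Metric.ball 0 (1 / 4)) :=
  hf.comp (differentiable_chart a).differentiableOn
    fun x hx => chart_mem ha (by simpa using hx)

/-- Apply the mean value inequality, raised to the power p by Hölder, to f in the chart at a. There
the weight is comparable to its value at a, and the Jacobian contributes the n+1 further powers of
the defect. -/
theorem exists_norm_mul_defect_rpow_le {p q α : ℝ} (hpq : p.HolderConjugate q) {f : Cn n → ℂ}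
    (hf : MemBergman p α f) :
    ∃ C : ℝ, 0 ≤ C ∧ ∀ a ∈ Ball n, ‖f a‖ * defect a ^ ((n + 1) / p + α) ≤ C := by
  obtain ⟨hfd, hfp⟩ := hf
  have hp := hpq.pos
  set V := lebesgue n (Metric.ball 0 (1 / 4)) with hV
  have hVtop : V ≠ ∞ := measure_ball_lt_top.ne
  have hV0 : V ≠ 0 := (Metric.measure_ball_pos _ _ (by norm_num)).ne'
  set I : ℝ≥0∞ := ∫⁻ w in Ball n, ENNReal.ofReal (defect w ^ (α * p)) * ‖f w‖ₑ ^ p ∂lebesgue n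
    with hI
  have hItop : I ≠ ∞ := by
    have h := hfp.2
    rw [eLpNorm_lt_top_iff_lintegral_rpow_enorm_lt_top (by simpa using hp) ENNReal.ofReal_ne_top,
      ENNReal.toReal_ofReal hp.le, ballMeasure, lintegral_smul_measure, smul_eq_mul] at h
    have h2 := (ENNReal.lt_top_of_mul_ne_top_right h.ne (ballMeasure_const_ne_zero n)).ne
    refine ne_of_eq_of_ne ?_ h2
    apply setLIntegral_congr_fun measurableSet_ball
    intro z hz
    have hd := defect_pos hz
    simp only
    rw [enorm_mul, ENNReal.mul_rpow_of_nonneg _ _ hp.le]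
    congr 1
    rw [enorm_eq_ofReal_norm_complex, Complex.norm_real]
    change _ = ENNReal.ofReal ‖defect z ^ α‖ ^ p
    rw [Real.norm_of_nonneg (by positivity), ENNReal.ofReal_rpow_of_pos (by positivity),
      ← Real.rpow_mul hd.le]
  set J : ℝ≥0∞ := ENNReal.ofReal (2 ^ |α * p|) * I * V⁻¹ with hJ
  have hJtop : J ≠ ∞ := ENNReal.mul_ne_top (ENNReal.mul_ne_top ENNReal.ofReal_ne_top hItop)
    (ENNReal.inv_ne_top.mpr hV0)
  refine ⟨J.toReal ^ (1 / p), by positivity, fun a ha => ?_⟩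
  have hd := defect_pos ha
  set g : Cn n → ℂ := fun x => f (chart a x) with hg
  have hgd : DifferentiableOn ℂ g (Metric.ball 0 (1 / 4)) := differentiableOn_comp_chart hfd ha
  have hg0 : g 0 = f a := by simp [hg, chart_zero]
  have hgm : AEMeasurable (fun x => ‖g x‖ₑ) ((lebesgue n).restrict (Metric.ball 0 (1 / 4))) :=
    (hgd.continuousOn.aestronglyMeasurable measurableSet_ball).enorm
  have h1 : ‖f a‖ₑ ^ p * V ≤ ∫⁻ x in Metric.ball 0 (1 / 4), ‖g x‖ₑ ^ p ∂lebesgue n := by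
    have h := ENNReal.rpow_le_rpow (enorm_mul_measure_le_lintegral hgd) hp.le
    rw [hg0, ENNReal.mul_rpow_of_nonneg _ _ hp.le] at h
    have h2 := h.trans (rpow_lintegral_le hpq hgm)
    rw [← hV] at h2
    have h3 : V ^ p = V * V ^ (p - 1) := by
      conv_lhs => rw [show p = 1 + (p - 1) by ring, ENNReal.rpow_add _ _ hV0 hVtop, ENNReal.rpow_one]
    rw [h3, ← mul_assoc] at h2
    exact (ENNReal.mul_le_mul_iff_left (by simp [hV0, hVtop, ENNReal.rpow_eq_zero_iff])
      (ENNReal.rpow_ne_top_of_nonneg hpq.sub_one_pos.le hVtop)).mp h2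
  have h2 : ENNReal.ofReal (defect a ^ (n + 1)) * (ENNReal.ofReal (defect a ^ (α * p)) *
      ∫⁻ x in Metric.ball 0 (1 / 4), ‖g x‖ₑ ^ p ∂lebesgue n) ≤
      ENNReal.ofReal (2 ^ |α * p|) * I := by
    calc _ ≤ ENNReal.ofReal (defect a ^ (n + 1)) * (ENNReal.ofReal (2 ^ |α * p|) *
          ∫⁻ x in Metric.ball 0 (1 / 4), ENNReal.ofReal (defect (chart a x) ^ (α * p)) *
            ‖f (chart a x)‖ₑ ^ p ∂lebesgue n) := by
          refine mul_le_mul_right ?_ _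
          rw [← lintegral_const_mul' _ _ ENNReal.ofReal_ne_top,
            ← lintegral_const_mul' _ _ ENNReal.ofReal_ne_top]
          apply setLIntegral_mono' measurableSet_ball
          intro x hx
          rw [mem_ball_zero_iff] at hx
          rw [← mul_assoc, ← ENNReal.ofReal_mul (by positivity)]
          gcongr
          obtain ⟨c1, c2⟩ := chart_bounds ha hx
          have h := (rpow_comparison hd c1 c2 (α * p)).1
          rwa [Real.rpow_neg (by norm_num), inv_mul_le_iff₀ (by positivity)] at h
      _ = ENNReal.ofReal (2 ^ |α * p|) * ∫⁻ w in chart a '' Metric.ball 0 (1 / 4),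
            ENNReal.ofReal (defect w ^ (α * p)) * ‖f w‖ₑ ^ p ∂lebesgue n := by
          rw [lintegral_chart ha measurableSet_ball]; ring
      _ ≤ _ := by
          gcongr
          apply lintegral_mono_set
          rintro w ⟨x, hx, rfl⟩
          exact chart_mem ha (by simpa using hx)
  have h3 : ENNReal.ofReal ((‖f a‖ * defect a ^ ((n + 1) / p + α)) ^ p) ≤ J := by
    rw [hJ, ← div_eq_mul_inv, ENNReal.le_div_iff_mul_le (Or.inl hV0) (Or.inl hVtop)]
    refine le_trans (le_of_eq ?_) ((mul_le_mul_right (mul_le_mul_right h1 _) _).trans h2)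
    rw [Real.mul_rpow (norm_nonneg _) (by positivity), ← Real.rpow_mul hd.le,
      ENNReal.ofReal_mul (by positivity), ← enorm_rpow_eq_ofReal hp.le]
    have : defect a ^ (((n : ℝ) + 1) / p * p + α * p) =
        defect a ^ (n + 1) * defect a ^ (α * p) := by
      rw [Real.rpow_add hd, div_mul_cancel₀ _ hp.ne', ← Real.rpow_natCast]
      push_cast; rfl
    rw [add_mul, this, ENNReal.ofReal_mul (by positivity)]
    ring
  have h4 : (‖f a‖ * defect a ^ ((n + 1) / p + α)) ^ p ≤ J.toReal :=
    (ENNReal.ofReal_le_iff_le_toReal hJtop).mp h3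
  have h5 := Real.rpow_le_rpow (by positivity) h4 (show 0 ≤ 1 / p by positivity)
  rwa [← Real.rpow_mul (by positivity), mul_one_div_cancel hp.ne', Real.rpow_one] at h5

theorem exists_norm_sub_mul_defect_rpow_le {p q α : ℝ} (hpq : p.HolderConjugate q) {f : Cn n → ℂ}
    (hf : MemBergman p α f) :
    ∃ C : ℝ, 0 ≤ C ∧ ∀ a b : Ball n, gleasonDist a b ≤ 1 / 16 →
      ‖f a - f b‖ * defect (a : Cn n) ^ ((n + 1) / p + α) ≤ C * gleasonDist a b := by
  obtain ⟨C, hC, h⟩ := exists_norm_mul_defect_rpow_le hpq hf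
  set X : ℝ := (n + 1) / p + α with hX
  refine ⟨16 * C * 2 ^ |X|, by positivity, fun a b hab => ?_⟩
  have hd := defect_pos a.2
  obtain ⟨x, hx⟩ := chart_surjective a.2 (b : Cn n)
  have hxn := norm_le_of_chart_eq hx (by linarith)
  have hx4 : x ∈ Metric.ball (0 : Cn n) (1 / 4) := by
    rw [mem_ball_zero_iff]; linarith
  set m : ℝ := C * 2 ^ |X| * defect (a : Cn n) ^ (-X) with hm
  have hbound : ∀ y ∈ Metric.ball (0 : Cn n) (1 / 4), ‖f (chart (a : Cn n) y)‖ ≤ m := by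
    intro y hy
    rw [mem_ball_zero_iff] at hy
    obtain ⟨c1, c2⟩ := chart_bounds a.2 hy
    have hdy := defect_pos (chart_mem a.2 hy)
    have h1 := h _ (chart_mem a.2 hy)
    have h2 := (rpow_comparison hd c1 c2 (-X)).2
    rw [abs_neg] at h2
    calc ‖f (chart (a : Cn n) y)‖ = (‖f (chart (a : Cn n) y)‖ * defect (chart (a : Cn n) y) ^ X) *
          defect (chart (a : Cn n) y) ^ (-X) := by
          rw [mul_assoc, ← Real.rpow_add hdy, add_neg_cancel, Real.rpow_zero, mul_one]
      _ ≤ C * (2 ^ |X| * defect (a : Cn n) ^ (-X)) := by gcongr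
      _ = m := by rw [hm]; ring
  -- Schwarz's lemma in the chart: f stays within 2m of f(a) on the ball of radius 1/4, and ‖x‖ is
  -- at most twice the distance. This gives the constant 2 · 4 · 2 = 16.
  have hS := Complex.dist_le_div_mul_dist_of_mapsTo_ball (R₂ := 2 * m)
    (differentiableOn_comp_chart hf.1 a.2) (fun y hy => by
      rw [mem_closedBall_iff_norm]
      refine (norm_sub_le _ _).trans ?_
      linarith [hbound y hy, hbound 0 (Metric.mem_ball_self (by norm_num))]) hx4
  simp only [chart_zero, hx, dist_eq_norm, sub_zero] at hS
  have hm0 : 0 ≤ m := by positivity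
  calc ‖f a - f b‖ * defect (a : Cn n) ^ X ≤ (2 * m / (1 / 4) * ‖x‖) * defect (a : Cn n) ^ X := by
        rw [norm_sub_rev]; gcongr
    _ ≤ (2 * m / (1 / 4) * (2 * gleasonDist a b)) * defect (a : Cn n) ^ X := by gcongr
    _ = 16 * C * 2 ^ |X| * gleasonDist a b *
        (defect (a : Cn n) ^ (-X) * defect (a : Cn n) ^ X) := by rw [hm]; ring
    _ = _ := by rw [← Real.rpow_add hd, neg_add_cancel, Real.rpow_zero, mul_one]

/-! ### Interpolating families are separated -/

/-- For each w in ℓ^p, interpolation and the oscillation estimate bound |w_k - ρ w_j| by C_w d(a_k,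
a_j). The quotients are functionals on ℓ^p, pointwise bounded and so uniformly bounded; on the k-th
unit vector they equal 1/d. Thus no norm control on the interpolating functions is needed
beforehand. -/
theorem isSeparated_of_isInterpolating {p q α : ℝ} (hpq : p.HolderConjugate q) {a : ι → Ball n}
    (ha : IsInterpolating p α a) : IsSeparated a := by
  classical
  have hp := hpq.pos
  have : Fact (1 ≤ ENNReal.ofReal p) := ⟨by rw [ENNReal.one_le_ofReal]; exact hpq.lt.le⟩
  let V := lp (fun _ : ι => ℂ) (ENNReal.ofReal p)
  set X : ℝ := (n + 1) / p + α with hX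
  have hpos : ∀ k, 0 < defect (a k : Cn n) ^ X := fun k => Real.rpow_pos_of_pos (defect_pos (a k).2) X
  let ρ : ι → ι → ℝ := fun k j => defect (a k : Cn n) ^ X / defect (a j : Cn n) ^ X
  have hosc : ∀ w : V, ∃ C : ℝ, 0 ≤ C ∧ ∀ k j, gleasonDist (a k) (a j) ≤ 1 / 16 →
      ‖w k - (ρ k j : ℂ) * w j‖ ≤ C * gleasonDist (a k) (a j) := by
    intro w
    obtain ⟨f, hf, hfv⟩ := ha (fun k => ((defect (a k : Cn n) ^ X : ℝ) : ℂ)⁻¹ * w k) (by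
      rw [MemWeightedLp]
      have e : (fun k => (((1 - ‖(a k : Cn n)‖ ^ 2) ^ X : ℝ) : ℂ) *
          (((defect (a k : Cn n) ^ X : ℝ) : ℂ)⁻¹ * w k)) = fun k => w k := by
        ext k
        have : ((defect (a k : Cn n) ^ X : ℝ) : ℂ) ≠ 0 := by exact_mod_cast (hpos k).ne'
        exact mul_inv_cancel_left₀ this _
      rw [e]
      exact lp.memℓp w)
    obtain ⟨C, hC, h⟩ := exists_norm_sub_mul_defect_rpow_le hpq hf
    refine ⟨C, hC, fun k j hkj => ?_⟩
    refine le_trans (le_of_eq ?_) (h (a k) (a j) hkj)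
    have hmul : ∀ z : ℂ, ‖z‖ * defect (a k : Cn n) ^ X =
        ‖z * ((defect (a k : Cn n) ^ X : ℝ) : ℂ)‖ := by
      intro z
      rw [norm_mul, Complex.norm_real, Real.norm_of_nonneg (hpos k).le]
    rw [hfv, hfv, hmul]
    congr 1
    have h1 : ((defect (a k : Cn n) ^ X : ℝ) : ℂ) ≠ 0 := by exact_mod_cast (hpos k).ne'
    have h2 : ((defect (a j : Cn n) ^ X : ℝ) : ℂ) ≠ 0 := by exact_mod_cast (hpos j).ne'
    simp only [ρ]
    rw [Complex.ofReal_div]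
    field_simp
  let P := {i : ι × ι // i.1 ≠ i.2 ∧ gleasonDist (a i.1) (a i.2) ≤ 1 / 16}
  let L : P → V →L[ℂ] ℂ := fun i => ((gleasonDist (a i.1.1) (a i.1.2) : ℝ) : ℂ)⁻¹ •
    (lp.evalCLM ℂ (fun _ : ι => ℂ) (ENNReal.ofReal p) i.1.1 -
      (ρ i.1.1 i.1.2 : ℂ) • lp.evalCLM ℂ (fun _ : ι => ℂ) (ENNReal.ofReal p) i.1.2)
  have hL : ∀ (i : P) (w : V), L i w = ((gleasonDist (a i.1.1) (a i.1.2) : ℝ) : ℂ)⁻¹ *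
      (w i.1.1 - (ρ i.1.1 i.1.2 : ℂ) * w i.1.2) := fun i w => rfl
  have hsingle : ∀ i : P, (lp.single (ENNReal.ofReal p) i.1.1 (1 : ℂ) : V) i.1.1 -
      (ρ i.1.1 i.1.2 : ℂ) * (lp.single (ENNReal.ofReal p) i.1.1 (1 : ℂ) : V) i.1.2 = 1 := by
    intro i
    have h1 : (lp.single (ENNReal.ofReal p) i.1.1 (1 : ℂ) : V) i.1.1 = 1 :=
      lp.single_apply_self (E := fun _ : ι => ℂ) _ _ _
    have h2 : (lp.single (ENNReal.ofReal p) i.1.1 (1 : ℂ) : V) i.1.2 = 0 :=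
      lp.single_apply_ne (E := fun _ : ι => ℂ) _ _ _ i.2.1.symm
    rw [h1, h2]; simp
  -- Distinct indices cannot carry the same point: the estimate for a unit vector would read 1 ≤ 0.
  -- The functionals divide by this distance.
  have hdpos : ∀ i : P, 0 < gleasonDist (a i.1.1) (a i.1.2) := by
    intro i
    obtain ⟨C, hC, h⟩ := hosc (lp.single (ENNReal.ofReal p) i.1.1 (1 : ℂ))
    have h1 := h i.1.1 i.1.2 i.2.2
    rw [hsingle i, norm_one] at h1
    by_contra h0
    have : gleasonDist (a i.1.1) (a i.1.2) = 0 := le_antisymm (not_lt.mp h0) (gleasonDist_nonneg _ _)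
    rw [this] at h1
    linarith
  obtain ⟨C, hC⟩ := banach_steinhaus (g := L) (by
    intro w
    obtain ⟨C, hC, h⟩ := hosc w
    refine ⟨C, fun i => ?_⟩
    rw [hL, norm_mul, norm_inv, Complex.norm_real, Real.norm_of_nonneg (hdpos i).le,
      inv_mul_le_iff₀ (hdpos i), mul_comm _ C]
    exact h _ _ i.2.2)
  refine ⟨min (1 / 16) (1 / (|C| + 1)), by positivity, fun j k hjk => ?_⟩
  rcases le_or_gt (gleasonDist (a j) (a k)) (1 / 16) with hle | hgt
  · let i : P := ⟨(j, k), hjk, hle⟩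
    refine (min_le_right _ _).trans ?_
    have h1 := (L i).le_opNorm (lp.single (ENNReal.ofReal p) i.1.1 (1 : ℂ))
    rw [hL, hsingle i, lp.norm_single (by simpa using hp), norm_one, mul_one, mul_one, norm_inv,
      Complex.norm_real, Real.norm_of_nonneg (hdpos i).le] at h1
    have h2 : (gleasonDist (a j) (a k))⁻¹ ≤ |C| + 1 :=
      h1.trans ((hC i).trans (by linarith [le_abs_self C]))
    have hd : 0 < gleasonDist (a j) (a k) := hdpos i
    rw [one_div]
    exact inv_le_of_inv_le₀ hd h2
  · exact (min_le_left _ _).trans hgt.le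

/-! ### Comparison with the quantities `K` -/

theorem K_eq (a : ι → Ball n) (s : ℝ) :
    K a s s = ⨆ k, ∑' j : {j // j ≠ k}, ENNReal.ofReal (affinity (a k : Cn n) (a j) ^ s) := by
  unfold K
  congr 1
  ext k
  congr 1
  ext j
  have h3 := pairing_pos (a k).2 (a (j : ι)).2
  rw [affinity_rpow (a k).2 (a j).2, Real.rpow_neg h3.le, ← div_eq_mul_inv, ← mul_div_assoc]
  rfl

/-- The surplus Y - X sits on the quotient (1-|w|²)/|1 - z̄w| ≤ 2, which is where the power of 2 in
(a) comes from. -/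
theorem gram_le_of_le {X Y : ℝ} (hXY : X ≤ Y) {z w : Cn n} (hz : z ∈ Ball n) (hw : w ∈ Ball n) :
    gram X Y z w ≤ 2 ^ (Y - X) * affinity z w ^ X := by
  have h1 := defect_pos hz
  have h2 := defect_pos hw
  have h3 := pairing_pos hz hw
  have e : gram X Y z w = (defect w / pairing z w) ^ (Y - X) * affinity z w ^ X := by
    rw [affinity_rpow hz hw, Real.div_rpow h2.le h3.le, div_eq_mul_inv, ← Real.rpow_neg h3.le, gram,
      show -(X + Y) = -(Y - X) + -(X + X) by ring, Real.rpow_add h3,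
      show Y = (Y - X) + X by ring, Real.rpow_add h2]
    ring_nf
  rw [e]
  have h4 : defect w / pairing z w ≤ 2 := by
    rw [div_le_iff₀ h3, pairing_comm]
    exact defect_le_two_mul_pairing (norm_lt_one_of_mem hw).le (norm_lt_one_of_mem hz).le
  have h5 := affinity_pos hz hw
  gcongr

theorem gram_le (X Y : ℝ) {z w : Cn n} (hz : z ∈ Ball n) (hw : w ∈ Ball n) :
    gram X Y z w ≤ 2 ^ |X - Y| * affinity z w ^ min X Y := by
  rcases le_total X Y with h | h
  · rw [min_eq_left h, abs_sub_comm, abs_of_nonneg (by linarith)]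
    exact gram_le_of_le h hz hw
  · rw [min_eq_right h, abs_of_nonneg (by linarith), gram_comm, affinity_comm]
    exact gram_le_of_le h hw hz

/-- Interpolation from a bound on the off-diagonal sums of powers of the affinity. -/
theorem isInterpolating_of_tsum_affinity [NeZero n] [Countable ι] {p q α Y δ c : ℝ}
    (hpq : p.HolderConjugate q) (hX : n / p < (n + 1) / p + α) (hY : n / q < Y) (hδ : 0 < δ)
    {a : ι → Ball n} (ha : SeparatedBy δ a) (hc0 : 0 ≤ c) (hc1 : c < 1)
    (h : ∀ k, ENNReal.ofReal (2 ^ |(n + 1) / p + α - Y|) * ∑' j : {j // j ≠ k},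
      ENNReal.ofReal (affinity (a k : Cn n) (a j) ^ min ((n + 1) / p + α) Y) ≤ ENNReal.ofReal c) :
    IsInterpolating p α a := by
  refine isInterpolating_of_gram_bound hpq hX hY hδ ha hc0 hc1 (fun k => ?_) fun k => ?_
  · refine le_trans ?_ (h k)
    rw [← ENNReal.tsum_mul_left]
    refine ENNReal.tsum_le_tsum fun j => ?_
    rw [← ENNReal.ofReal_mul (by positivity)]
    exact ENNReal.ofReal_le_ofReal (gram_le _ _ (a k).2 (a j).2)
  · refine le_trans ?_ (h k)
    rw [← ENNReal.tsum_mul_left]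
    refine ENNReal.tsum_le_tsum fun j => ?_
    rw [← ENNReal.ofReal_mul (by positivity), affinity_comm]
    exact ENNReal.ofReal_le_ofReal (gram_le _ _ (a j).2 (a k).2)

/-- Taking A-th roots gives 1 - d² ≤ c^(1/A), and d ≥ d² because 0 ≤ d < 1. -/
theorem separatedBy_of_affinity_rpow_le {a : ι → Ball n} {A c : ℝ} (hA : 0 < A)
    (h : ∀ j k, j ≠ k → affinity (a j : Cn n) (a k) ^ A ≤ c) :
    SeparatedBy (1 - c ^ (1 / A)) a := by
  intro j k hjk
  have h1 := affinity_pos (a j).2 (a k).2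
  have h2 := Real.rpow_le_rpow (by positivity) (h j k hjk) (show 0 ≤ 1 / A by positivity)
  rw [← Real.rpow_mul h1.le, mul_one_div_cancel hA.ne', Real.rpow_one, affinity_eq] at h2
  have h3 := gleasonDist_lt_one (a j) (a k)
  have h4 := gleasonDist_nonneg (a j) (a k)
  nlinarith

/-! ### Proofs of the four assertions -/

theorem isInterpolating_of_K_le [NeZero n] [Countable ι] {p q α c₀ : ℝ}
    (hpq : p.HolderConjugate q) (hα : -1 / p < α) {a : ι → Ball n} (hc₀ : c₀ < 1)
    (hK : K a (critExp n p q α) (critExp n p q α) ≤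
      ENNReal.ofReal ((2 : ℝ) ^ (-((n + 1 + α * p) * |1 - 2 / p|)) * c₀)) :
    IsInterpolating p α a := by
  have hp := hpq.pos
  have hq := hpq.symm.pos
  set N : ℝ := n + 1 + α * p with hN
  have hNn : n < N := by
    rw [div_lt_iff₀ hp] at hα; linarith
  have hN0 : 0 < N := lt_of_le_of_lt (Nat.cast_nonneg n) hNn
  have hXN : ((n : ℝ) + 1) / p + α = N / p := by rw [hN]; field_simp
  set A := critExp n p q α with hA
  have hAmin : A = min (N / p) (N / q) := by
    rw [hA, critExp, ← hN, mul_min_of_nonneg _ _ hN0.le, mul_one_div, mul_one_div]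
  have hA0 : 0 < A := by rw [hAmin]; positivity
  have habs : |N / p - N / q| = N * |1 - 2 / p| := by
    have : N / p - N / q = -(N * (1 - 2 / p)) := by
      have h1 := hpq.inv_add_inv_eq_one
      have h2 : q⁻¹ = 1 - p⁻¹ := by linarith
      rw [div_eq_mul_inv N q, h2]; ring
    rw [this, abs_neg, abs_mul, abs_of_pos hN0]
  -- The given constant may be negative, while the contraction argument needs c ≥ 0.
  set c : ℝ := max c₀ 0 with hc
  have hc0 : 0 ≤ c := le_max_right _ _
  have hc1 : c < 1 := max_lt hc₀ one_pos
  set e : ℝ := N * |1 - 2 / p| with he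
  have he0 : 0 ≤ e := by positivity
  have hK' : ∀ k, ∑' j : {j // j ≠ k}, ENNReal.ofReal (affinity (a k : Cn n) (a j) ^ A) ≤
      ENNReal.ofReal (2 ^ (-e) * c) := by
    intro k
    rw [K_eq] at hK
    refine ((le_iSup (fun k => ∑' j : {j // j ≠ k},
      ENNReal.ofReal (affinity (a k : Cn n) (a j) ^ A)) k).trans hK).trans ?_
    apply ENNReal.ofReal_le_ofReal
    gcongr
    exact le_max_left _ _
  have hsep : SeparatedBy (1 - c ^ (1 / A)) a := by
    apply separatedBy_of_affinity_rpow_le hA0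
    intro k j hkj
    have h1 := (ENNReal.le_tsum (f := fun j : {j // j ≠ k} =>
      ENNReal.ofReal (affinity (a k : Cn n) (a j) ^ A)) ⟨j, hkj.symm⟩).trans (hK' k)
    rw [ENNReal.ofReal_le_ofReal_iff (by positivity)] at h1
    refine h1.trans (mul_le_of_le_one_left hc0 ?_)
    exact Real.rpow_le_one_of_one_le_of_nonpos (by norm_num) (by linarith)
  -- With X = N/p and Y = N/q both exponent conditions reduce to N > n, min(X, Y) = A, and 2^|X-Y|
  -- cancels the power of 2 in the hypothesis. Separation comes from single terms of the sum.
  refine isInterpolating_of_tsum_affinity hpq (Y := N / q) (by rw [hXN]; gcongr) (by gcongr)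
    (by have := Real.rpow_lt_one hc0 hc1 (show 0 < 1 / A by positivity); linarith) hsep hc0 hc1
    fun k => ?_
  rw [hXN, ← hAmin, habs]
  refine (mul_le_mul_right (hK' k) _).trans (le_of_eq ?_)
  rw [← ENNReal.ofReal_mul (by positivity), ← mul_assoc, ← Real.rpow_add (by norm_num),
    add_neg_cancel, Real.rpow_zero, one_mul]

/-- Off-diagonal sums over a family with large mutual distances are small. -/
theorem tsum_affinity_ne_le {a : ι → Ball n} {δ s e C : ℝ} (hδ0 : 0 < δ) (hδ1 : δ < 1) (he : 0 ≤ e)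
    (ha : SeparatedBy δ a) (k : ι)
    (h : ∑' j, ENNReal.ofReal (affinity (a k : Cn n) (a j) ^ s) ≤ ENNReal.ofReal C) :
    ∑' j : {j // j ≠ k}, ENNReal.ofReal (affinity (a k : Cn n) (a j) ^ (s + e)) ≤
      ENNReal.ofReal ((1 - δ ^ 2) ^ e * C) := by
  have h1 : 0 < 1 - δ ^ 2 := by nlinarith
  calc _ ≤ ∑' j : {j // j ≠ k}, ENNReal.ofReal ((1 - δ ^ 2) ^ e) *
        ENNReal.ofReal (affinity (a k : Cn n) (a j) ^ s) := by
        refine ENNReal.tsum_le_tsum fun j => ?_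
        have h2 := affinity_pos (a k).2 (a (j : ι)).2
        rw [← ENNReal.ofReal_mul (by positivity)]
        apply ENNReal.ofReal_le_ofReal
        rw [Real.rpow_add h2, mul_comm]
        have h3 : affinity (a k : Cn n) (a j) ≤ 1 - δ ^ 2 := by
          rw [affinity_eq]
          have := ha k j j.2.symm
          nlinarith
        gcongr
    _ ≤ ENNReal.ofReal ((1 - δ ^ 2) ^ e) *
        ∑' j, ENNReal.ofReal (affinity (a k : Cn n) (a j) ^ s) := by
        rw [ENNReal.tsum_mul_left]
        gcongr
        exact ENNReal.tsum_comp_le_tsum_of_injective Subtype.val_injective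
          (fun j => ENNReal.ofReal (affinity (a k : Cn n) (a j) ^ s))
    _ ≤ _ := by
        rw [ENNReal.ofReal_mul (by positivity)]
        gcongr

/-- Taking Y = X avoids any power of 2, so only the size of the exponent X matters, and it grows
with α. -/
theorem exists_isInterpolating_of_isSeparated [NeZero n] [Countable ι] {p q : ℝ}
    (hpq : p.HolderConjugate q) {a : ι → Ball n} (ha : IsSeparated a) :
    ∃ α : ℝ, 0 < α ∧ IsInterpolating p α a := by
  have hp := hpq.pos
  have hq := hpq.symm.pos
  obtain ⟨δ₀, hδ₀, hsep₀⟩ := ha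
  -- A family with at most one member is separated with any δ₀, even δ₀ ≥ 1; truncation keeps 1 - δ²
  -- positive.
  set δ := min δ₀ (1 / 2) with hδ
  have hδ0 : 0 < δ := by positivity
  have hδ1 : δ < 1 := (min_le_right _ _).trans_lt (by norm_num)
  have hsep : SeparatedBy δ a := fun j k hjk => (min_le_left _ _).trans (hsep₀ j k hjk)
  obtain ⟨C, hC, h⟩ := exists_tsum_affinity_rpow_le (n := n) hδ0
    (show (n : ℝ) < n + 1 by linarith)
  have h1 : 0 < 1 - δ ^ 2 := by nlinarith
  have h1' : 1 - δ ^ 2 < 1 := by nlinarith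
  obtain ⟨m, hm⟩ := exists_pow_lt_of_lt_one (show 0 < 1 / (2 * C) by positivity) h1'
  set α : ℝ := m + n + 1 with hα
  have hn : (0 : ℝ) < n := by exact_mod_cast NeZero.pos n
  have hq1 : n / q < (n : ℝ) := div_lt_self hn hpq.symm.lt
  have hY : n / q < (n + 1) / p + α := by
    have : 0 < ((n : ℝ) + 1) / p := by positivity
    have : (0 : ℝ) ≤ m := Nat.cast_nonneg m
    linarith
  refine ⟨α, by positivity, isInterpolating_of_tsum_affinity hpq (Y := (n + 1) / p + α) (c := 1 / 2)
    ?_ hY hδ0 hsep (by norm_num) (by norm_num) fun k => ?_⟩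
  · have : n / p ≤ ((n : ℝ) + 1) / p := by gcongr; linarith
    have : 0 < α := by positivity
    linarith
  · rw [sub_self, abs_zero, Real.rpow_zero, ENNReal.ofReal_one, one_mul, min_self]
    have h2 := tsum_affinity_ne_le (s := n + 1) (e := (n + 1) / p + m) hδ0 hδ1 (by positivity)
      hsep k (h ι a hsep (a k) (a k).2)
    rw [show ((n : ℝ) + 1) / p + α = n + 1 + ((n + 1) / p + m) by rw [hα]; ring]
    refine h2.trans (ENNReal.ofReal_le_ofReal ?_)
    have h3 : (1 - δ ^ 2) ^ (((n : ℝ) + 1) / p + m) ≤ (1 - δ ^ 2) ^ m := by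
      rw [← Real.rpow_natCast (1 - δ ^ 2) m]
      apply Real.rpow_le_rpow_of_exponent_ge h1 h1'.le
      have : 0 < ((n : ℝ) + 1) / p := by positivity
      linarith
    calc (1 - δ ^ 2) ^ (((n : ℝ) + 1) / p + m) * C ≤ 1 / (2 * C) * C := by
          gcongr; exact h3.trans hm.le
      _ = 1 / 2 := by field_simp

theorem neg_one_div_lt_of_lt_critExp {p q α : ℝ} (hpq : p.HolderConjugate q)
    (hA : n < critExp n p q α) : -1 / p < α := by
  have hp := hpq.pos
  have hq := hpq.symm.pos
  have hm1 : min (1 / p) (1 / q) ≤ 1 :=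
    (min_le_left _ _).trans (by rw [div_le_one hp]; exact hpq.lt.le)
  have hm0 : 0 < min (1 / p) (1 / q) := by positivity
  have hn : (0 : ℝ) ≤ n := Nat.cast_nonneg n
  unfold critExp at hA
  have hN0 : 0 < n + 1 + α * p := pos_of_mul_pos_left (hn.trans_lt hA) hm0.le
  rw [div_lt_iff₀ hp]
  nlinarith

/-- Keep a power s with n < s < A for the convergence of the sums and use the surplus e = A - s as a
small factor (1-δ²)^e. The constant C is fixed for separation 1/2 before δ ≥ 1/2 is chosen, so there
is no circularity. -/
theorem exists_separation_constant [NeZero n] {p q α : ℝ} (hpq : p.HolderConjugate q)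
    (hA : n < critExp n p q α) :
    ∃ δ : ℝ, 0 < δ ∧ δ < 1 ∧ ∀ (ι : Type) [Countable ι] (a : ι → Ball n),
      SeparatedBy δ a → IsInterpolating p α a := by
  obtain ⟨s, hs1, hs2⟩ := exists_between hA
  obtain ⟨C, hC, h⟩ := exists_tsum_affinity_rpow_le (n := n) (δ := 1 / 2) (by norm_num) hs1
  set e : ℝ := critExp n p q α - s with he
  have he0 : 0 < e := by linarith
  set κ : ℝ := (2 : ℝ) ^ (-((n + 1 + α * p) * |1 - 2 / p|)) with hκ
  have hκ0 : 0 < κ := by positivity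
  -- Here x is the future 1 - δ²: x ≤ 3/4 means δ ≥ 1/2, and the second term gives x^e C ≤ κ/2, the
  -- hypothesis of (a) with c₀ = 1/2.
  set x : ℝ := min (3 / 4) ((κ / (2 * C)) ^ (1 / e)) with hx
  have hx0 : 0 < x := by positivity
  have hx1 : x ≤ 3 / 4 := min_le_left _ _
  have hsq : Real.sqrt (1 - x) ^ 2 = 1 - x := Real.sq_sqrt (by linarith)
  have hδ2 : 1 / 2 ≤ Real.sqrt (1 - x) := by
    rw [Real.le_sqrt' (by norm_num)]; linarith
  have hδ1 : Real.sqrt (1 - x) < 1 := by rw [Real.sqrt_lt' one_pos]; linarith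
  refine ⟨Real.sqrt (1 - x), by linarith, hδ1, fun ι _ a ha => ?_⟩
  refine isInterpolating_of_K_le hpq (neg_one_div_lt_of_lt_critExp hpq hA) (c₀ := 1 / 2)
    (by norm_num) ?_
  rw [K_eq]
  refine iSup_le fun k => ?_
  have h2 := tsum_affinity_ne_le (e := e) (by linarith) hδ1 he0.le ha k
    (h ι a (fun j k hjk => hδ2.trans (ha j k hjk)) (a k) (a k).2)
  rw [show s + e = critExp n p q α by rw [he]; ring, hsq] at h2
  refine h2.trans (ENNReal.ofReal_le_ofReal ?_)
  rw [sub_sub_cancel]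
  have h3 : x ^ e ≤ κ / (2 * C) := by
    calc x ^ e ≤ ((κ / (2 * C)) ^ (1 / e)) ^ e := by gcongr; exact min_le_right _ _
      _ = κ / (2 * C) := by
        rw [← Real.rpow_mul (by positivity), one_div_mul_cancel he0.ne', Real.rpow_one]
  calc x ^ e * C ≤ κ / (2 * C) * C := by gcongr
    _ = κ * (1 / 2) := by field_simp

theorem isFiniteUnionOf_separated_iff [NeZero n] [Countable ι] {p q α : ℝ}
    (hpq : p.HolderConjugate q) (hA : n < critExp n p q α) (a : ι → Ball n) :
    IsFiniteUnionOf (fun _ b => IsSeparated b) a ↔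
      IsFiniteUnionOf (fun _ b => IsInterpolating p α b) a := by
  constructor
  · rintro ⟨N, S, hS, hsep⟩
    obtain ⟨δ, hδ0, hδ1, hint⟩ := exists_separation_constant hpq hA
    choose M T hT hTsep using fun i => exists_finite_cover_of_separated (hsep i) hδ1
    -- Each separated piece is cut into finitely many δ-separated ones; the pairs (piece, subpiece)
    -- are renumbered by a single finite index.
    let e := Fintype.equivFin (Σ i : Fin N, Fin (M i))
    let U : (Σ i : Fin N, Fin (M i)) → Set ι := fun x => Subtype.val '' T x.1 x.2
    refine ⟨_, fun m => U (e.symm m), ?_, fun m => ?_⟩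
    · rw [eq_univ_iff_forall]
      intro k
      obtain ⟨i, hi⟩ := mem_iUnion.mp ((eq_univ_iff_forall.mp hS) k)
      obtain ⟨j, hj⟩ := mem_iUnion.mp ((eq_univ_iff_forall.mp (hT i)) ⟨k, hi⟩)
      exact mem_iUnion.mpr ⟨e ⟨i, j⟩, by simpa [U] using ⟨hi, hj⟩⟩
    · apply hint
      rintro ⟨j, hj⟩ ⟨k, hk⟩ hjk
      obtain ⟨j', hj', rfl⟩ := hj
      obtain ⟨k', hk', rfl⟩ := hk
      exact hTsep _ _ j' hj' k' hk' fun h => hjk (by subst h; rfl)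
  · rintro ⟨N, S, hS, hint⟩
    exact ⟨N, S, hS, fun i => isSeparated_of_isInterpolating hpq (hint i)⟩

end WeightedBergman

theorem corollary4p6 (n : ℕ) (hn : 1 ≤ n) (p q : ℝ) (hp : 1 < p) (hpq : p.HolderConjugate q) :
    -- (a)
    (∀ α : ℝ, -1 / p < α →
      ∀ (ι : Type) [Countable ι] (a : ι → WeightedBergman.Ball n),
        (∃ c₀ : ℝ, c₀ < 1 ∧
          WeightedBergman.K a (WeightedBergman.critExp n p q α) (WeightedBergman.critExp n p q α) ≤
            ENNReal.ofReal ((2 : ℝ) ^ (-((n + 1 + α * p) * |1 - 2 / p|)) * c₀)) →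
        WeightedBergman.IsInterpolating p α a) ∧
    -- (b)
    (∀ (ι : Type) [Countable ι] (a : ι → WeightedBergman.Ball n),
      WeightedBergman.IsSeparated a →
        ∃ α : ℝ, 0 < α ∧ WeightedBergman.IsInterpolating p α a) ∧
    -- (c)
    (∀ α : ℝ, n < WeightedBergman.critExp n p q α →
      ∃ δ : ℝ, 0 < δ ∧ δ < 1 ∧
        ∀ (ι : Type) [Countable ι] (a : ι → WeightedBergman.Ball n),
          (∀ j k : ι, j ≠ k → δ ≤ WeightedBergman.gleasonDist (a j) (a k)) →
            WeightedBergman.IsInterpolating p α a) ∧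
    -- (d)
    (∀ α : ℝ, n < WeightedBergman.critExp n p q α →
      ∀ (ι : Type) [Countable ι] (a : ι → WeightedBergman.Ball n),
        WeightedBergman.IsFiniteUnionOf (fun _ b => WeightedBergman.IsSeparated b) a ↔
          WeightedBergman.IsFiniteUnionOf
            (fun _ b => WeightedBergman.IsInterpolating p α b) a) := by
  have : NeZero n := ⟨by omega⟩
  exact ⟨fun α hα ι _ a ⟨_, hc₀, hK⟩ => WeightedBergman.isInterpolating_of_K_le hpq hα hc₀ hK,
    fun ι _ a ha => WeightedBergman.exists_isInterpolating_of_isSeparated hpq ha,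
    fun α hA => WeightedBergman.exists_separation_constant hpq hA,
    fun α hA ι _ a => WeightedBergman.isFiniteUnionOf_separated_iff hpq hA a⟩
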